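/- A $d$-dimensional VASS-MDP is a tuple $S=\langle Q,Q_1,Q_P,T,\tau\rangle$, where $Q$ is a finite set of control states partitioned into the states $Q_1$ of Player 1 and the probabilistic states $Q_P$, $T\subseteq Q\times\mathbb Z^d\times Q$ is a finite set of transitions, and $\tau$ assigns to each transition a positive integer weight. A configuration is a pair $\langle q,\mathbf v\rangle\in Q\times\mathbb N^d$. A transition $\langle q,\mathbf z,q'\rangle$ is enabled in $\langle q,\mathbf v\rangle$ if $\mathbf v+\mathbf z\ge \mathbf 0$, and it then leads to $\langle q',\mathbf v+\mathbf z\rangle$. If $q\in Q_1$, Player 1 chooses the successor by means of a strategy, that is, a function of the finite play so far; if $q\in Q_P$, an enabled transition is drawn at random with probability proportional to its weight. $S$ is deadlock-free if every configuration has an enabled transition, and it is a P-VASS-MDP if $\mathbf z=\mathbf 0$ for every transition $\langle q,\mathbf z,q'\rangle\in T$ with $q\in Q_1$. A strategy $\sigma$ and an initial configuration $c_0$ induce a probability measure $\mathbb P_{c_0}^{\sigma}$ on infinite plays. Given $S$, an initial configuration $c_0$ and a control state $q_F$, let $E$ be the event that $q_F$ is visited at least once (reachability) or infinitely often (repeated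 reachability). The almost-sure problem for $E$ asks whether there is a strategy $\sigma$ with $\mathbb P_{c_0}^{\sigma}(E)=1$; the limit-sure problem asks whether $\sup_\sigma \mathbb P_{c_0}^{\sigma}(E)=1$. **Theorem.** The almost-sure reachability problem, the limit-sure reachability problem, the almost-sure repeated reachability problem and the limit-sure repeated reachability problem are all undecidable for 2-dimensional deadlock-free P-VASS-MDPs. -/

import Mathlib

open MeasureTheory ProbabilityTheory
open scoped ENNReal

noncomputable section

namespace VASS

/-- A transition `(src, vec, tgt) ∈ Q × ℤ^d × Q` of a `d`-dimensional VASS. -/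
@[ext]
structure Transition (Q : Type) (d : ℕ) where
  src : Q
  vec : Fin d → ℤ
  tgt : Q

/-- A configuration: a control state together with a vector of natural numbers. -/
@[ext]
structure Config (Q : Type) (d : ℕ) where
  state : Q
  val : Fin d → ℕ

/-- The set of configurations is a discrete space. -/
instance (Q : Type) (d : ℕ) : MeasurableSpace (Config Q d) := ⊤

instance (Q : Type) (d : ℕ) : DiscreteMeasurableSpace (Config Q d) := ⟨fun _ => trivial⟩

instance (Q : Type) (d : ℕ) [Finite Q] : Countable (Config Q d) :=
  Function.Injective.countable (f := fun c : Config Q d => (c.state, c.val)) (by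
    rintro ⟨q, v⟩ ⟨q', v'⟩ h
    simpa using h)

/-- `t` is enabled in `c`: it leaves the control state of `c`, and no counter becomes negative. -/
def Transition.Enabled {Q : Type} {d : ℕ} (t : Transition Q d) (c : Config Q d) : Prop :=
  t.src = c.state ∧ ∀ i, 0 ≤ (c.val i : ℤ) + t.vec i

/-- The configuration reached by firing `t` in `c` (meaningful when `t` is enabled in `c`). -/
def Transition.fire {Q : Type} {d : ℕ} (t : Transition Q d) (c : Config Q d) : Config Q d where
  state := t.tgt
  val i := ((c.val i : ℤ) + t.vec i).toNat

end VASS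

open VASS

/-- A `d`-dimensional VASS-MDP with control states `Q` (used for finite `Q`). The control states are
partitioned into those of Player 1, `Q₁`, and the probabilistic ones, `Q_P = Q \ Q₁`; there are
finitely many transitions, and each carries a positive integer weight
(values of `weight` outside `T` play no role). -/
structure VASSMDP (Q : Type) (d : ℕ) where
  Q₁ : Finset Q
  T : Finset (Transition Q d)
  weight : Transition Q d → ℕ
  weight_pos : ∀ t ∈ T, 0 < weight t

namespace VASSMDP

variable {Q : Type} {d : ℕ}

/-- The transition relation of the induced MDP. -/
def Step (S : VASSMDP Q d) (c c' : Config Q d) : Prop :=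
  ∃ t ∈ S.T, t.Enabled c ∧ c' = t.fire c

/-- Every configuration has a successor. -/
def DeadlockFree (S : VASSMDP Q d) : Prop :=
  ∀ c : Config Q d, ∃ c', S.Step c c'

/-- P-VASS-MDP: no transition leaving a state of Player 1 changes the counters. -/
def IsPVASS (S : VASSMDP Q d) : Prop :=
  ∀ t ∈ S.T, t.src ∈ S.Q₁ → t.vec = 0

open Classical in
/-- The weight of `t` if `t` is a transition of `S` enabled in `c`, and `0` otherwise. -/
def enabledWeight (S : VASSMDP Q d) (c : Config Q d) (t : Transition Q d) : ℝ≥0∞ :=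
  if t ∈ S.T ∧ t.Enabled c then (S.weight t : ℝ≥0∞) else 0

theorem tsum_enabledWeight (S : VASSMDP Q d) (c : Config Q d) :
    ∑' t, S.enabledWeight c t = ∑ t ∈ S.T, S.enabledWeight c t :=
  tsum_eq_sum fun t ht => by simp [enabledWeight, ht]

theorem tsum_enabledWeight_ne_top (S : VASSMDP Q d) (c : Config Q d) :
    ∑' t, S.enabledWeight c t ≠ ∞ := by
  rw [tsum_enabledWeight]
  refine ENNReal.sum_ne_top.2 fun t _ => ?_
  unfold enabledWeight
  split_ifs <;> simp

theorem tsum_enabledWeight_ne_zero (S : VASSMDP Q d) (hS : S.DeadlockFree) (c : Config Q d) :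
    ∑' t, S.enabledWeight c t ≠ 0 := by
  obtain ⟨_, t, ht, hen, _⟩ := hS c
  intro h
  have h0 := ENNReal.tsum_eq_zero.1 h t
  rw [enabledWeight, if_pos ⟨ht, hen⟩] at h0
  exact (S.weight_pos t ht).ne' (by exact_mod_cast h0)

/-- The successor distribution of the induced MDP at a probabilistic configuration `c`: an enabled
transition is drawn with probability its weight divided by the sum of the weights of all enabled
transitions, and is then fired. -/
def succDist (S : VASSMDP Q d) (hS : S.DeadlockFree) (c : Config Q d) : PMF (Config Q d) :=
  (PMF.normalize (S.enabledWeight c) (S.tsum_enabledWeight_ne_zero hS c)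
    (S.tsum_enabledWeight_ne_top c)).map fun t => t.fire c

/-- A sequence `c₀, …, cₙ` of configurations. -/
abbrev History (Q : Type) (d n : ℕ) : Type :=
  (i : Finset.Iic n) → Config Q d

/-- The last configuration `cₙ` of a history. -/
def History.last {n : ℕ} (h : History Q d n) : Config Q d :=
  h ⟨n, Finset.mem_Iic.2 le_rfl⟩

/-- A (deterministic, history dependent) strategy of Player 1: after a finite play that ends in a
configuration of Player 1 it picks a successor of that configuration. Its values on sequences
that are not plays, or that end in a probabilistic configuration, play no role. -/
structure Strategy (S : VASSMDP Q d) where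
  move : (n : ℕ) → History Q d n → Config Q d
  move_step : ∀ (n : ℕ) (h : History Q d n), h.last.state ∈ S.Q₁ →
    (∃ c', S.Step h.last c') → S.Step h.last (move n h)

variable [Finite Q]

open Classical in
/-- The law of the next configuration, given the history, under the strategy `σ`. -/
def stepKernel (S : VASSMDP Q d) (hS : S.DeadlockFree) (σ : S.Strategy) (n : ℕ) :
    Kernel (History Q d n) (Config Q d) :=
  Kernel.ofFunOfCountable fun h =>
    if h.last.state ∈ S.Q₁ then Measure.dirac (σ.move n h)
    else (S.succDist hS h.last).toMeasure

instance (S : VASSMDP Q d) (hS : S.DeadlockFree) (σ : S.Strategy) (n : ℕ) :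
    IsMarkovKernel (S.stepKernel hS σ n) := by
  classical
  refine ⟨fun h => ?_⟩
  change IsProbabilityMeasure
    (if h.last.state ∈ S.Q₁ then Measure.dirac (σ.move n h) else (S.succDist hS h.last).toMeasure)
  split_ifs <;> infer_instance

/-- The probability measure on infinite sequences of configurations (starting at `c₀`) that is
induced by the strategy `σ`, given by the Ionescu-Tulcea theorem. -/
def playMeasure (S : VASSMDP Q d) (hS : S.DeadlockFree) (σ : S.Strategy) (c₀ : Config Q d) :
    Measure (ℕ → Config Q d) :=
  Kernel.traj (X := fun _ => Config Q d) (S.stepKernel hS σ) 0 fun _ => c₀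

end VASSMDP

/-- The sequences that visit the control state `q`. -/
def reachEvent {Q : Type} {d : ℕ} (q : Q) : Set (ℕ → Config Q d) :=
  {ω | ∃ n, (ω n).state = q}

/-- The sequences that visit the control state `q` infinitely often. -/
def repeatedReachEvent {Q : Type} {d : ℕ} (q : Q) : Set (ℕ → Config Q d) :=
  {ω | ∀ N, ∃ n ≥ N, (ω n).state = q}

/-- An input of the (repeated) reachability problems for `d`-dimensional deadlock-free
P-VASS-MDPs: such a system (its control states numbered `0, …, numStates - 1`), an initial
configuration and a target control state. -/
structure PInstance (d : ℕ) where
  numStates : ℕ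
  sys : VASSMDP (Fin numStates) d
  deadlockFree : sys.DeadlockFree
  isPVASS : sys.IsPVASS
  init : Config (Fin numStates) d
  target : Fin numStates

namespace PInstance

variable {d : ℕ}

/-- The probability of an event when Player 1 uses `σ` from the initial configuration. -/
def prob (I : PInstance d) (σ : I.sys.Strategy) (E : Set (ℕ → Config (Fin I.numStates) d)) :
    ℝ≥0∞ :=
  I.sys.playMeasure I.deadlockFree σ I.init E

def AlmostSureReach (I : PInstance d) : Prop :=
  ∃ σ : I.sys.Strategy, I.prob σ (reachEvent I.target) = 1

def LimitSureReach (I : PInstance d) : Prop :=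
  (⨆ σ : I.sys.Strategy, I.prob σ (reachEvent I.target)) = 1

def AlmostSureRepeatedReach (I : PInstance d) : Prop :=
  ∃ σ : I.sys.Strategy, I.prob σ (repeatedReachEvent I.target) = 1

def LimitSureRepeatedReach (I : PInstance d) : Prop :=
  (⨆ σ : I.sys.Strategy, I.prob σ (repeatedReachEvent I.target)) = 1

/-- Finite descriptions of inputs: for each control state whether it belongs to Player 1; the
list of transitions as (source, vector, target, weight); the initial state and vector; the target
state. -/
abbrev Code : Type :=
  List Bool × List (ℕ × List ℤ × ℕ × ℕ) × (ℕ × List ℕ) × ℕ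

/-- The code of a transition and its weight. -/
def transitionCode (I : PInstance d) (t : Transition (Fin I.numStates) d) :
    ℕ × List ℤ × ℕ × ℕ :=
  (t.src, List.ofFn t.vec, t.tgt, I.sys.weight t)

/-- `w` describes `I`; the transitions may be listed in any order, without repetitions. -/
structure IsCode (I : PInstance d) (w : Code) : Prop where
  states : w.1 = List.ofFn fun q => decide (q ∈ I.sys.Q₁)
  nodup : w.2.1.Nodup
  transitions : ∀ e, e ∈ w.2.1 ↔ ∃ t ∈ I.sys.T, e = I.transitionCode t
  init : w.2.2.1 = ((I.init.state : ℕ), List.ofFn I.init.val)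
  target : w.2.2.2 = (I.target : ℕ)

end PInstance

/-- A property of inputs is decidable if some computable function on descriptions answers
correctly on every description of every input. -/
def DecidableProblem {d : ℕ} (P : PInstance d → Prop) : Prop :=
  ∃ f : PInstance.Code → Bool, Computable f ∧
    ∀ (I : PInstance d) (w : PInstance.Code), I.IsCode w → (f w = true ↔ P I)

end

/-! The undecidability comes from recursive inseparability: no computable function separates the `n`
with diagonal value `0` from those with diagonal value `1` (`not_computable_separation`). One fixed
`ResidueMachine`, started on `2 ^ n`, tells the two cases apart by its exit
(`exists_machine_of_partrec`); as in Minsky's reduction, registers are exponents of primes in a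
single number. Nothing need be known about runs that never exit.

The machine is simulated by a fixed MDP with two counters, one for the current number and one for
the next. Player 1 cannot touch the counters; he only announces that another modulus can be
subtracted, or which residue is left, and probabilistic states carry this out. Zero self-loops
exclude deadlocks: a possible update is made eventually with probability one, an impossible one
leaves the play waiting forever. After an announced residue, `check` tries a decrement: at a nonzero
counter it is drawn with probability 1/2 and leads to `sink`, at zero it is disabled. So honesty is
free, while a lie blocks the play or costs half of the probability.

If the machine exits with `false`, honest play reaches the absorbing `accept` almost surely, hence
visits it infinitely often (`prob_repeatedReach_accept`). If it exits with `true`, every strategy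
reaches `accept` with probability at most 1/2 (`prob_reach_accept_le`), because `cfgBound` is
superharmonic. This gap settles all four problems at once (`not_decidableProblem`). -/

open VASS

namespace VASSMDP

/-! ### Play measures: superharmonic bounds, positional strategies, repeated visits. -/

section PlayMeasure

variable {Q : Type} {d : ℕ} [Finite Q] (S : VASSMDP Q d) (hS : S.DeadlockFree) (σ : S.Strategy)
  (c₀ : Config Q d)

instance : IsProbabilityMeasure (S.playMeasure hS σ c₀) := by
  unfold playMeasure; infer_instance

theorem lintegral_playMeasure_zero (f : Config Q d → ℝ≥0∞) :
    ∫⁻ ω, f (ω 0) ∂S.playMeasure hS σ c₀ = f c₀ := by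
  have h := Kernel.traj_map_frestrictLe_apply (X := fun _ => Config Q d) (κ := S.stepKernel hS σ) 0 0
    (fun _ => c₀)
  have h2 : ∫⁻ ω, f (ω 0) ∂S.playMeasure hS σ c₀ =
      ∫⁻ x : History Q d 0, f x.last ∂(S.playMeasure hS σ c₀).map (Preorder.frestrictLe 0) := by
    rw [lintegral_map (measurable_of_countable _) (Preorder.measurable_frestrictLe 0)]
    rfl
  rw [h2, playMeasure, h]
  simp [Kernel.id_apply, lintegral_dirac, History.last]

/-- One-step conditioning, from the Ionescu-Tulcea joint law of a history and the next
configuration. The integrand sees the whole history because the stopped process below does. -/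
theorem lintegral_playMeasure_succ (n : ℕ) (f : History Q d n → Config Q d → ℝ≥0∞) :
    ∫⁻ ω, f (Preorder.frestrictLe n ω) (ω (n + 1)) ∂S.playMeasure hS σ c₀ =
      ∫⁻ ω, ∫⁻ y, f (Preorder.frestrictLe n ω) y
        ∂(S.stepKernel hS σ n (Preorder.frestrictLe n ω)) ∂S.playMeasure hS σ c₀ := by
  have h := Kernel.partialTraj_compProd_eq_map_traj (X := fun _ => Config Q d)
    (κ := S.stepKernel hS σ) (Nat.zero_le n) (x₀ := fun _ => c₀)
  have h0 := Kernel.traj_map_frestrictLe_apply (X := fun _ => Config Q d) (κ := S.stepKernel hS σ) 0 n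
    (fun _ => c₀)
  have hm : Measurable (Function.uncurry f) := measurable_of_countable _
  calc _ = ∫⁻ z, Function.uncurry f z ∂((S.playMeasure hS σ c₀).map
        fun x => (Preorder.frestrictLe n x, x (n + 1))) := by
        rw [lintegral_map hm (by fun_prop)]; rfl
    _ = _ := by
        rw [playMeasure, ← h, Measure.lintegral_compProd hm, ← h0,
          lintegral_map (measurable_of_countable _) (Preorder.measurable_frestrictLe n)]
        rfl

-- The process that equals `V` before the first visit to `q` and `1` from then on has nonincreasing
-- expectation under any history-dependent strategy, and it dominates the indicator of a past visit.
open Classical in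
theorem prob_reachEvent_le (q : Q) (V : Config Q d → ℝ≥0∞)
    (hq : ∀ c : Config Q d, c.state = q → 1 ≤ V c)
    (h₁ : ∀ c c', c.state ∈ S.Q₁ → S.Step c c' → V c' ≤ V c)
    (hP : ∀ c, c.state ∉ S.Q₁ → ∫⁻ y, V y ∂(S.succDist hS c).toMeasure ≤ V c) :
    S.playMeasure hS σ c₀ (reachEvent q) ≤ V c₀ := by
  let A : ℕ → Set (ℕ → Config Q d) := fun n => {ω | ∃ k ≤ n, (ω k).state = q}
  have hA : reachEvent q = ⋃ n, A n := by
    ext ω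
    simp only [reachEvent, A, Set.mem_iUnion, Set.mem_ofPred_eq]
    exact ⟨fun ⟨n, h⟩ => ⟨n, n, le_rfl, h⟩, fun ⟨_, k, _, h⟩ => ⟨k, h⟩⟩
  have hmono : Monotone A := fun m n hmn ω ⟨k, hk, h⟩ => ⟨k, hk.trans hmn, h⟩
  have hmeas : ∀ k, MeasurableSet {ω : ℕ → Config Q d | (ω k).state = q} := fun k =>
    measurable_pi_apply (X := fun _ => Config Q d) k (t := {c | c.state = q}) trivial
  have hAm : ∀ n, MeasurableSet (A n) := fun n => by
    have : A n = ⋃ k ∈ Set.Iic n, {ω | (ω k).state = q} := by ext; simp [A]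
    rw [this]
    exact .biUnion (Set.to_countable _) fun k _ => hmeas k
  let U : ℕ → (ℕ → Config Q d) → ℝ≥0∞ := fun n ω => if ω ∈ A n then 1 else V (ω n)
  have hU : ∀ n, ∫⁻ ω, U n ω ∂S.playMeasure hS σ c₀ ≤ V c₀ := by
    intro n
    induction n with
    | zero =>
      rw [← S.lintegral_playMeasure_zero hS σ c₀ V]
      refine lintegral_mono fun ω => ?_
      simp only [U, A, Nat.le_zero, exists_eq_left, Set.mem_ofPred_eq]
      split_ifs with h
      exacts [hq _ h, le_rfl]
    | succ n ih =>
      -- This tests for visits up to time `n` only; a first visit at time `n + 1` is absorbed by `1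
      -- ≤ V y`.
      let f : History Q d n → Config Q d → ℝ≥0∞ := fun h y =>
        if ∃ k, (h k).state = q then 1 else V y
      have hf : ∀ ω : ℕ → Config Q d, (∃ k, ((Preorder.frestrictLe n ω : History Q d n) k).state = q)
          ↔ ω ∈ A n := by
        intro ω
        simp [A]
      calc _ ≤ ∫⁻ ω, f (Preorder.frestrictLe n ω) (ω (n + 1)) ∂S.playMeasure hS σ c₀ := by
            refine lintegral_mono fun ω => ?_
            simp only [U, f, hf]
            by_cases h : ω ∈ A n
            · rw [if_pos h, if_pos (hmono n.le_succ h)]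
            · rw [if_neg h]
              split_ifs with h'
              · obtain ⟨k, hk, hkq⟩ := h'
                rcases Nat.le_succ_iff.1 hk with hk | rfl
                · exact absurd ⟨k, hk, hkq⟩ h
                · exact hq _ hkq
              · exact le_rfl
        _ = _ := S.lintegral_playMeasure_succ hS σ c₀ n f
        _ ≤ ∫⁻ ω, U n ω ∂S.playMeasure hS σ c₀ := by
            refine lintegral_mono fun ω => ?_
            simp only [U, f, hf]
            by_cases h : ω ∈ A n
            · simp [h]
            · simp only [h, if_false]
              change ∫⁻ y, V y ∂(if _ then _ else _) ≤ _
              have hl : History.last (Preorder.frestrictLe n ω) = ω n := rfl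
              split_ifs with h1
              · rw [lintegral_dirac]
                have hd : ∃ c', S.Step (ω n) c' := hS _
                exact h₁ _ _ h1 (σ.move_step n (Preorder.frestrictLe n ω) h1 hd)
              · exact hP _ h1
        _ ≤ _ := ih
  rw [hA, hmono.measure_iUnion]
  refine iSup_le fun n => le_trans ?_ (hU n)
  rw [← lintegral_indicator_one (hAm n)]
  refine lintegral_mono fun ω => ?_
  by_cases h : ω ∈ A n <;> simp [U, h]

/-- The one-step expectation operator of a positional choice function. -/
noncomputable def positionalOp (m : Config Q d → Config Q d) (g : Config Q d → ℝ≥0∞)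
    (c : Config Q d) : ℝ≥0∞ :=
  open Classical in
  if c.state ∈ S.Q₁ then g (m c) else ∫⁻ y, g y ∂(S.succDist hS c).toMeasure

omit [Finite Q] in
theorem positionalOp_mono (m : Config Q d → Config Q d) : Monotone (S.positionalOp hS m) := by
  intro f g h c
  unfold positionalOp
  split_ifs
  exacts [h _, lintegral_mono h]

/-- The strategy that plays according to a positional choice function. -/
def positional (m : Config Q d → Config Q d)
    (hm : ∀ c, c.state ∈ S.Q₁ → S.Step c (m c)) : S.Strategy where
  move _ h := m h.last
  move_step _ _ h _ := hm _ h

-- The induction peels off the last step. Unfolding the iterate at its other end later gives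
-- first-step analysis without a Markov property of shifted plays.
open Classical in
theorem lintegral_positional (m : Config Q d → Config Q d)
    (hm : ∀ c, c.state ∈ S.Q₁ → S.Step c (m c)) (n : ℕ) (g : Config Q d → ℝ≥0∞) :
    ∫⁻ ω, g (ω n) ∂S.playMeasure hS (S.positional m hm) c₀ = (S.positionalOp hS m)^[n] g c₀ := by
  induction n generalizing g with
  | zero => exact S.lintegral_playMeasure_zero hS _ c₀ g
  | succ n ih =>
    rw [S.lintegral_playMeasure_succ hS _ c₀ n fun _ y => g y, Function.iterate_succ_apply, ← ih]
    refine lintegral_congr fun ω => ?_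
    unfold positionalOp
    change ∫⁻ y, g y ∂(if _ then _ else _) = _
    have hl : History.last (Preorder.frestrictLe n ω) = ω n := rfl
    rw [hl]
    split_ifs with h1
    · rw [lintegral_dirac]; rfl
    · rfl

open Classical in
theorem prob_state_positional (m : Config Q d → Config Q d)
    (hm : ∀ c, c.state ∈ S.Q₁ → S.Step c (m c)) (n : ℕ) (q : Q) :
    S.playMeasure hS (S.positional m hm) c₀ {ω | (ω n).state = q} =
      (S.positionalOp hS m)^[n] (fun c => if c.state = q then 1 else 0) c₀ := by
  rw [← S.lintegral_positional hS c₀ m hm n, ← lintegral_indicator_one]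
  · refine lintegral_congr fun ω => ?_
    simp [Set.indicator]
  · exact measurable_pi_apply (X := fun _ => Config Q d) n (t := {c | c.state = q}) trivial

omit [Finite Q] in
theorem repeatedReachEvent_subset_reachEvent (q : Q) :
    repeatedReachEvent (d := d) q ⊆ reachEvent q := fun _ h =>
  let ⟨n, _, hn⟩ := h 0
  ⟨n, hn⟩

/-- For each `N` a visit at or after time `N` is almost sure, and countably many almost sure events
are intersected. -/
theorem prob_repeatedReachEvent_eq_one (q : Q)
    (h : ∀ N, ⨆ n, S.playMeasure hS σ c₀ {ω | (ω (N + n)).state = q} = 1) :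
    S.playMeasure hS σ c₀ (repeatedReachEvent q) = 1 := by
  have hE : repeatedReachEvent q = ⋂ N, ⋃ n, {ω : ℕ → Config Q d | (ω (N + n)).state = q} := by
    ext ω
    simp only [repeatedReachEvent, Set.mem_ofPred_eq, Set.mem_iInter, Set.mem_iUnion]
    exact forall_congr' fun N => ⟨fun ⟨n, hn, hq⟩ => ⟨n - N, by rwa [Nat.add_sub_cancel' hn]⟩,
      fun ⟨n, hn⟩ => ⟨N + n, Nat.le_add_right _ _, hn⟩⟩
  have hmeas : ∀ k, MeasurableSet {ω : ℕ → Config Q d | (ω k).state = q} := fun k =>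
    measurable_pi_apply (X := fun _ => Config Q d) k (t := {c | c.state = q}) trivial
  rw [hE, ← prob_compl_eq_zero_iff (.iInter fun N => .iUnion fun n => hmeas _), Set.compl_iInter,
    measure_iUnion_null_iff]
  intro N
  rw [prob_compl_eq_zero_iff (.iUnion fun n => hmeas _)]
  refine le_antisymm prob_le_one ((h N).symm.le.trans (iSup_le fun n => measure_mono ?_))
  exact Set.subset_iUnion (fun n => {ω : ℕ → Config Q d | (ω (N + n)).state = q}) n

end PlayMeasure

/-! ### One-step expectations at probabilistic configurations. -/

section SuccDist

variable {Q : Type} {d : ℕ} [Finite Q] (S : VASSMDP Q d) (hS : S.DeadlockFree) {c : Config Q d}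

/-- Summing over transitions rather than successors means that transitions with a common successor
need no separate treatment. -/
theorem lintegral_succDist (g : Config Q d → ℝ≥0∞) :
    ∫⁻ y, g y ∂(S.succDist hS c).toMeasure =
      (∑' t, S.enabledWeight c t * g (t.fire c)) * (∑' t, S.enabledWeight c t)⁻¹ := by
  classical
  rw [lintegral_countable']
  simp only [PMF.toMeasure_apply_singleton _ _ (measurableSet_singleton _), succDist,
    PMF.map_apply, PMF.normalize_apply, ← ENNReal.tsum_mul_left, ← ENNReal.tsum_mul_right]
  rw [ENNReal.tsum_comm]
  refine tsum_congr fun t => ?_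
  rw [tsum_eq_single (t.fire c)]
  · simp; ring
  · intro b hb; simp [hb]

theorem lintegral_succDist_single (g : Config Q d → ℝ≥0∞) (t₁ : Transition Q d)
    (h : ∀ t, t ∈ S.T ∧ t.Enabled c ↔ t = t₁) :
    ∫⁻ y, g y ∂(S.succDist hS c).toMeasure = g (t₁.fire c) := by
  have hw : S.weight t₁ ≠ 0 := (S.weight_pos t₁ ((h t₁).2 rfl).1).ne'
  rw [lintegral_succDist, tsum_eq_single t₁, tsum_eq_single t₁]
  · simp only [enabledWeight, h, if_true]
    rw [mul_right_comm, ENNReal.mul_inv_cancel (by exact_mod_cast hw) (by simp), one_mul]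
  all_goals
    intro t ht
    simp [enabledWeight, h, ht]

theorem lintegral_succDist_pair (g : Config Q d → ℝ≥0∞) (t₁ t₂ : Transition Q d) (hne : t₁ ≠ t₂)
    (h : ∀ t, t ∈ S.T ∧ t.Enabled c ↔ t = t₁ ∨ t = t₂) (hw : ∀ t, S.weight t = 1) :
    ∫⁻ y, g y ∂(S.succDist hS c).toMeasure = (g (t₁.fire c) + g (t₂.fire c)) / 2 := by
  classical
  have key : ∀ f : Transition Q d → ℝ≥0∞,
      ∑' t, S.enabledWeight c t * f t = f t₁ + f t₂ := by
    intro f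
    rw [tsum_eq_sum (s := {t₁, t₂}), Finset.sum_pair hne]
    · simp [enabledWeight, h, hw]
    · intro t ht
      rw [Finset.mem_insert, Finset.mem_singleton] at ht
      simp [enabledWeight, h, ht]
  have key1 := key fun _ => 1
  simp only [mul_one] at key1
  rw [lintegral_succDist, key fun t => g (t.fire c), key1, ENNReal.div_eq_inv_mul, mul_comm,
    one_add_one_eq_two]

end SuccDist

end VASSMDP

/-! ### Residue machines and their combinators. -/

/-- A machine with finitely many states that acts on one natural number: in state `s` the number
`m * k + r` with `r < m = modulus s` is replaced by `factor s * k + offset s r`, and control passes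
to the state or the exit `next s r`. -/
structure ResidueMachine (X : Type) where
  S : Type
  finite : Finite S
  start : S
  modulus : S → ℕ
  factor : S → ℕ
  offset : S → ℕ → ℕ
  next : S → ℕ → S ⊕ X
  modulus_pos : ∀ s, 0 < modulus s

namespace ResidueMachine

attribute [instance] ResidueMachine.finite

variable {X Y : Type}

inductive Step (M : ResidueMachine X) : (M.S ⊕ X) × ℕ → (M.S ⊕ X) × ℕ → Prop
  | mk (s : M.S) (k r : ℕ) (h : r < M.modulus s) :
    Step M (.inl s, M.modulus s * k + r) (M.next s r, M.factor s * k + M.offset s r)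

def Eval (M : ResidueMachine X) (N : ℕ) (x : X) (N' : ℕ) : Prop :=
  Relation.ReflTransGen M.Step (.inl M.start, N) (.inr x, N')

/-- Multiplication by `p`. -/
def mul (p : ℕ) : ResidueMachine Unit where
  S := Unit
  finite := inferInstance
  start := ()
  modulus _ := 1
  factor _ := p
  offset _ _ := 0
  next _ _ := .inr ()
  modulus_pos _ := one_pos

theorem eval_mul (p N : ℕ) : (mul p).Eval N () (p * N) := by
  have := Step.mk (M := mul p) () N 0 one_pos
  simp only [mul, one_mul, add_zero] at this
  exact .single this

/-- Division by `p`. -/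
def div (p : ℕ) (hp : 0 < p) : ResidueMachine Unit where
  S := Unit
  finite := inferInstance
  start := ()
  modulus _ := p
  factor _ := 1
  offset _ _ := 0
  next _ _ := .inr ()
  modulus_pos _ := hp

theorem eval_div (p N : ℕ) (hp : 0 < p) : (div p hp).Eval (p * N) () N := by
  have := Step.mk (M := div p hp) () N 0 hp
  simp only [div, one_mul, add_zero] at this
  exact .single this

/-- Divisibility test by `p`. -/
def test (p : ℕ) (hp : 0 < p) : ResidueMachine Bool where
  S := Unit
  finite := inferInstance
  start := ()
  modulus _ := p
  factor _ := p
  offset _ r := r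
  next _ r := .inr (decide (r = 0))
  modulus_pos _ := hp

theorem eval_test (p N : ℕ) (hp : 0 < p) : (test p hp).Eval N (decide (p ∣ N)) N := by
  have := Step.mk (M := test p hp) () (N / p) (N % p) (Nat.mod_lt _ hp)
  simp only [test, Nat.div_add_mod, ← Nat.dvd_iff_mod_eq_zero] at this
  exact .single this

/-- Run `M`, then continue with `K x`, where `x` is the exit of `M`. -/
def bind [Finite X] (M : ResidueMachine X) (K : X → ResidueMachine Y) : ResidueMachine Y where
  S := M.S ⊕ Σ x, (K x).S
  finite := inferInstance
  start := .inl M.start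
  modulus := Sum.elim M.modulus fun z => (K z.1).modulus z.2
  factor := Sum.elim M.factor fun z => (K z.1).factor z.2
  offset := Sum.elim M.offset fun z => (K z.1).offset z.2
  next := Sum.elim
    (fun s r => .inl ((M.next s r).map id fun x => ⟨x, (K x).start⟩))
    (fun z r => ((K z.1).next z.2 r).map (fun s => .inr ⟨z.1, s⟩) id)
  modulus_pos := by
    rintro (s | z)
    exacts [M.modulus_pos s, (K z.1).modulus_pos z.2]

theorem Eval.bind [Finite X] {M : ResidueMachine X} {K : X → ResidueMachine Y} {N N' N'' : ℕ}
    {x : X} {y : Y} (h : M.Eval N x N') (h' : (K x).Eval N' y N'') :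
    (M.bind K).Eval N y N'' := by
  have h1 := Relation.ReflTransGen.lift (p := (M.bind K).Step)
    (fun z : (M.S ⊕ X) × ℕ =>
      ((.inl (z.1.map id fun x => ⟨x, (K x).start⟩) : (M.bind K).S ⊕ Y), z.2))
    (by rintro _ _ ⟨s, k, r, hr⟩; exact Step.mk (M := M.bind K) (.inl s) k r hr) _ _ h
  have h2 := Relation.ReflTransGen.lift (p := (M.bind K).Step)
    (fun z : ((K x).S ⊕ Y) × ℕ =>
      ((z.1.map (fun s => .inr ⟨x, s⟩) id : (M.bind K).S ⊕ Y), z.2))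
    (by rintro _ _ ⟨s, k, r, hr⟩; exact Step.mk (M := M.bind K) (.inr ⟨x, s⟩) k r hr) _ _ h'
  exact h1.trans h2

/-- Run `M` as long as the number is divisible by `p`. -/
def whileDvd (p : ℕ) (hp : 0 < p) (M : ResidueMachine Unit) : ResidueMachine Unit where
  -- `none` is the divisibility test, which leaves the number unchanged; `some s` runs the body.
  S := Option M.S
  finite := inferInstance
  start := none
  modulus s := s.elim p M.modulus
  factor s := s.elim p M.factor
  offset s r := s.elim r fun s => M.offset s r
  next s r := s.elim (if r = 0 then .inl (some M.start) else .inr ())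
    fun s => .inl ((M.next s r).elim some fun _ => none)
  modulus_pos := by
    rintro (_ | s)
    exacts [hp, M.modulus_pos s]

theorem eval_whileDvd_of_not_dvd {p N : ℕ} (hp : 0 < p) (M : ResidueMachine Unit)
    (h : ¬ p ∣ N) : (whileDvd p hp M).Eval N () N := by
  have := Step.mk (M := whileDvd p hp M) none (N / p) (N % p) (Nat.mod_lt _ hp)
  simp only [whileDvd, Option.elim_none, Nat.div_add_mod, ← Nat.dvd_iff_mod_eq_zero, h,
    if_false] at this
  exact .single this

theorem eval_whileDvd_of_dvd {p N N' N'' : ℕ} (hp : 0 < p) {M : ResidueMachine Unit}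
    (h : p ∣ N) (h1 : M.Eval N () N') (h2 : (whileDvd p hp M).Eval N' () N'') :
    (whileDvd p hp M).Eval N () N'' := by
  have h0 := Step.mk (M := whileDvd p hp M) none (N / p) (N % p) (Nat.mod_lt _ hp)
  simp only [whileDvd, Option.elim_none, Nat.div_add_mod, ← Nat.dvd_iff_mod_eq_zero, h,
    if_true] at h0
  have h3 := Relation.ReflTransGen.lift (p := (whileDvd p hp M).Step)
    (fun z : (M.S ⊕ Unit) × ℕ =>
      ((.inl (z.1.elim some fun _ => none) : (whileDvd p hp M).S ⊕ Unit), z.2))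
    (by rintro _ _ ⟨s, k, r, hr⟩; exact Step.mk (M := whileDvd p hp M) (some s) k r hr) _ _ h1
  exact (Relation.ReflTransGen.head h0 h3).trans h2

end ResidueMachine

/-! ### Registers as prime exponents, and register programs. -/

/-- `N` encodes the register contents `s`: register `i` is the exponent of the `i`-th prime. -/
def RegisterCode (s : ℕ → ℕ) (N : ℕ) : Prop :=
  N ≠ 0 ∧ ∀ i, N.factorization (Nat.nth Nat.Prime i) = s i

namespace RegisterCode

open Function

variable {s : ℕ → ℕ} {N : ℕ}

theorem dvd_iff (h : RegisterCode s N) (i : ℕ) : Nat.nth Nat.Prime i ∣ N ↔ s i ≠ 0 := by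
  rw [← h.2 i, (Nat.prime_nth_prime i).dvd_iff_one_le_factorization h.1, Nat.one_le_iff_ne_zero]

theorem mul (h : RegisterCode s N) (i : ℕ) :
    RegisterCode (update s i (s i + 1)) (Nat.nth Nat.Prime i * N) := by
  refine ⟨mul_ne_zero (Nat.prime_nth_prime i).ne_zero h.1, fun j => ?_⟩
  rw [Nat.factorization_mul (Nat.prime_nth_prime i).ne_zero h.1, Finsupp.add_apply, h.2,
    (Nat.prime_nth_prime i).factorization, Finsupp.single_apply, update_apply]
  simp only [(Nat.nth_injective Nat.infinite_setOfPred_prime).eq_iff]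
  by_cases hij : i = j
  · simp [hij, add_comm]
  · simp [hij, Ne.symm hij]

theorem exists_mul (h : RegisterCode s N) {i : ℕ} (hi : s i ≠ 0) :
    ∃ N', N = Nat.nth Nat.Prime i * N' ∧ RegisterCode (update s i (s i - 1)) N' := by
  obtain ⟨N', rfl⟩ := (h.dvd_iff i).2 hi
  have hN : N' ≠ 0 := right_ne_zero_of_mul h.1
  refine ⟨N', rfl, hN, fun j => ?_⟩
  have hs := h.2
  simp only [Nat.factorization_mul (Nat.prime_nth_prime i).ne_zero hN, Finsupp.add_apply,
    (Nat.prime_nth_prime i).factorization, Finsupp.single_apply,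
    (Nat.nth_injective Nat.infinite_setOfPred_prime).eq_iff] at hs
  rw [update_apply]
  have hj := hs j
  split_ifs with hij
  · subst hij; simp at hj; omega
  · simpa [Ne.symm hij] using hj

theorem init (n : ℕ) : RegisterCode (update (fun _ => 0) 0 n) (2 ^ n) := by
  refine ⟨by positivity, fun j => ?_⟩
  rw [Nat.prime_two.factorization_pow, ← Nat.nth_prime_zero_eq_two, Finsupp.single_apply,
    update_apply]
  simp only [(Nat.nth_injective Nat.infinite_setOfPred_prime).eq_iff, eq_comm]

end RegisterCode

/-- Some machine transforms the codes of register contents as prescribed by the relation `R`. -/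
def Realizable (R : (ℕ → ℕ) → (ℕ → ℕ) → Prop) : Prop :=
  ∃ M : ResidueMachine Unit, ∀ s s' N, R s s' → RegisterCode s N →
    ∃ N', RegisterCode s' N' ∧ M.Eval N () N'

namespace Realizable

open Function

variable {R R' : (ℕ → ℕ) → (ℕ → ℕ) → Prop}

/-- `R` is promise and specification in one: nothing is asked of contents without an `R`-successor.
Programs are thus verified by composing relations and exhibiting the intermediate contents of the
intended runs. -/
theorem mono (h : Realizable R) (hR : ∀ s s', R' s s' → R s s') : Realizable R' :=
  h.imp fun _ hM s s' N hs => hM s s' N (hR s s' hs)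

theorem inc (i : ℕ) : Realizable fun s s' => s' = update s i (s i + 1) :=
  ⟨.mul (Nat.nth Nat.Prime i), fun _ _ _ h hN => h ▸ ⟨_, hN.mul i, ResidueMachine.eval_mul _ _⟩⟩

theorem dec (i : ℕ) : Realizable fun s s' => s i ≠ 0 ∧ s' = update s i (s i - 1) := by
  refine ⟨.div (Nat.nth Nat.Prime i) (Nat.prime_nth_prime i).pos, ?_⟩
  rintro s s' N ⟨h0, rfl⟩ hN
  obtain ⟨N', rfl, hN'⟩ := hN.exists_mul h0
  exact ⟨N', hN', ResidueMachine.eval_div _ _ _⟩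

theorem comp (h : Realizable R) (h' : Realizable R') : Realizable (Relation.Comp R R') := by
  obtain ⟨M, hM⟩ := h
  obtain ⟨M', hM'⟩ := h'
  refine ⟨M.bind fun _ => M', ?_⟩
  rintro s s'' N ⟨s', h1, h2⟩ hN
  obtain ⟨N', hN', e1⟩ := hM _ _ _ h1 hN
  obtain ⟨N'', hN'', e2⟩ := hM' _ _ _ h2 hN'
  exact ⟨N'', hN'', e1.bind e2⟩

/-- The finite chain of iterations is itself the termination proof, so partial loops need no
measure. -/
theorem loop (i : ℕ) (h : Realizable R) : Realizable fun s s' =>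
    Relation.ReflTransGen (fun s s' => s i ≠ 0 ∧ R s s') s s' ∧ s' i = 0 := by
  obtain ⟨M, hM⟩ := h
  refine ⟨M.whileDvd (Nat.nth Nat.Prime i) (Nat.prime_nth_prime i).pos, ?_⟩
  rintro s s' N ⟨hss, h0⟩ hN
  induction hss using Relation.ReflTransGen.head_induction_on generalizing N with
  | refl =>
    exact ⟨N, hN, ResidueMachine.eval_whileDvd_of_not_dvd _ _
      fun hd => (hN.dvd_iff i).1 hd h0⟩
  | head h1 _ ih =>
    obtain ⟨N', hN', e1⟩ := hM _ _ _ h1.2 hN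
    obtain ⟨N'', hN'', e2⟩ := ih _ hN'
    exact ⟨N'', hN'', ResidueMachine.eval_whileDvd_of_dvd _ ((hN.dvd_iff i).2 h1.1) e1 e2⟩

end Realizable

namespace Realizable

open Function

/-- A machine starts in a state, never at an exit, so there is no empty program; an increment undone
by a decrement replaces it. -/
theorem id : Realizable fun s s' => s' = s :=
  ((inc 0).comp (dec 0)).mono fun s s' h => ⟨_, rfl, by simp, by simp [h]⟩

theorem clear (i : ℕ) : Realizable fun s s' => s' = update s i 0 := by
  refine ((dec i).loop i).mono fun s s' h => ?_
  subst h
  refine ⟨?_, by simp⟩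
  generalize hn : s i = n
  induction n generalizing s with
  | zero => rw [← hn, update_eq_self]
  | succ n ih =>
    have h2 := ih (update s i n) (by simp)
    rw [update_idem] at h2
    exact .head ⟨by simp [hn], by simp [hn], by simp [hn]⟩ h2

theorem move {i j : ℕ} (hij : i ≠ j) :
    Realizable fun s s' => s' = update (update s j (s j + s i)) i 0 := by
  refine (((dec i).comp (inc j)).loop i).mono fun s s' h => ?_
  subst h
  refine ⟨?_, by simp⟩
  generalize hn : s i = n
  induction n generalizing s with
  | zero => rw [add_zero, update_eq_self, ← hn, update_eq_self]
  | succ n ih =>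
    have h2 := ih (update (update s i n) j (s j + 1)) (by simp [hij])
    refine .head ⟨by simp [hn], _, ⟨by simp [hn], rfl⟩, rfl⟩ ?_
    convert! h2 using 1
    · ext x; clear h2 ih; simp only [update_apply]; grind
    · ext x; clear h2 ih; simp only [update_apply]; grind

/-- Emptying `i` destroys it, so its content is also collected in the scratch register `t` and then
moved back, which leaves `t` empty again. -/
theorem addTo {i j t : ℕ} (hij : i ≠ j) (hit : i ≠ t) (hjt : j ≠ t) :
    Realizable fun s s' => s t = 0 ∧ s' = update s j (s j + s i) := by
  refine ((((dec i).comp ((inc j).comp (inc t))).loop i).comp (move hit.symm)).mono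
    fun s s' h => ?_
  obtain ⟨ht, rfl⟩ := h
  refine ⟨update (update (update s j (s j + s i)) t (s i)) i 0, ⟨?_, by simp⟩, ?_⟩
  -- The content of `t` must be arbitrary for the induction, since every round increments it.
  · suffices ∀ n (s : ℕ → ℕ), s i = n →
        Relation.ReflTransGen (fun s s' => s i ≠ 0 ∧
          Relation.Comp (fun s s' => s i ≠ 0 ∧ s' = update s i (s i - 1))
            (Relation.Comp (fun s s' => s' = update s j (s j + 1))
              fun s s' => s' = update s t (s t + 1)) s s')
          s (update (update (update s j (s j + s i)) t (s t + s i)) i 0) by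
      simpa [ht] using this _ s rfl
    intro n
    induction n with
    | zero =>
      intro s hn
      rw [hn, add_zero, update_eq_self, add_zero, update_eq_self, ← hn, update_eq_self]
    | succ n ih =>
      intro s hn
      have h2 := ih (update (update (update s i n) j (s j + 1)) t (s t + 1)) (by simp [hij, hit])
      refine .head ⟨by simp [hn], _, ⟨by simp [hn], rfl⟩, _, rfl, rfl⟩ ?_
      convert! h2 using 1
      · ext x; clear h2 ih; simp only [update_apply]; grind
      · ext x; clear h2 ih; simp only [update_apply]; grind
  · ext x; simp only [update_apply]; grind

theorem seq {n : ℕ} (R : Fin n → (ℕ → ℕ) → (ℕ → ℕ) → Prop) (h : ∀ k, Realizable (R k)) :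
    Realizable fun s s' => ∃ st : ℕ → ℕ → ℕ, st 0 = s ∧ st n = s' ∧
      ∀ k : Fin n, R k (st k) (st (k + 1)) := by
  induction n with
  | zero => exact id.mono fun s s' ⟨st, h0, h1, _⟩ => h1.symm.trans h0
  | succ n ih =>
    refine ((ih (fun k => R k.castSucc) fun k => h _).comp (h (Fin.last n))).mono
      fun s s' ⟨st, h0, h1, h2⟩ => ⟨st n, ⟨st, h0, rfl, fun k => h2 k.castSucc⟩, ?_⟩
    rw [← h1]
    exact h2 (Fin.last n)

end Realizable

/-! ### Partial recursive functions on residue machines. -/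

/-- Some machine evaluates `f` on the arguments in the registers `inp` and writes the result to the
empty register `out`; the registers from `base` on are empty before and after. -/
def RealizesFun {n : ℕ} (f : List.Vector ℕ n →. ℕ) : Prop :=
  ∀ (inp : Fin n → ℕ) (out base : ℕ), (∀ i, inp i < base) → out < base → (∀ i, inp i ≠ out) →
    Realizable fun s s' => s out = 0 ∧ (∀ j ≥ base, s j = 0) ∧
      ∃ y ∈ f (List.Vector.ofFn fun i => s (inp i)), s' = Function.update s out y

namespace RealizesFun

open Function

theorem zero : RealizesFun (n := 0) ((fun _ => 0 : List.Vector ℕ 0 → ℕ) : List.Vector ℕ 0 →. ℕ) := by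
  intro inp out base _ _ _
  refine Realizable.id.mono ?_
  rintro s s' ⟨h0, -, y, hy, rfl⟩
  obtain rfl := Part.mem_some_iff.1 hy
  have hs := update_eq_self out s
  rw [h0] at hs
  exact hs

theorem get {n : ℕ} (i : Fin n) :
    RealizesFun ((fun v => v.get i : List.Vector ℕ n → ℕ) : List.Vector ℕ n →. ℕ) := by
  intro inp out base h1 h2 h3
  refine (Realizable.addTo (h3 i) (h1 i).ne h2.ne).mono ?_
  rintro s s' ⟨h0, hb, y, hy, rfl⟩
  obtain rfl := Part.mem_some_iff.1 hy
  simp [h0, hb]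

theorem succ : RealizesFun (n := 1)
    ((fun v => Nat.succ v.head : List.Vector ℕ 1 → ℕ) : List.Vector ℕ 1 →. ℕ) := by
  intro inp out base h1 h2 h3
  refine ((get 0 inp out base h1 h2 h3).comp (Realizable.inc out)).mono ?_
  rintro s s' ⟨h0, hb, y, hy, rfl⟩
  obtain rfl := Part.mem_some_iff.1 hy
  refine ⟨_, ⟨h0, hb, _, Part.mem_some _, rfl⟩, ?_⟩
  simp

/-- The hypothesis `hh` covers composition both of total functions and of partial ones. Intermediate
values occupy the registers `base + i`, which are cleared at the end. -/
theorem comp {m n : ℕ} {f : List.Vector ℕ n →. ℕ} {g : Fin n → List.Vector ℕ m →. ℕ}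
    (hf : RealizesFun f) (hg : ∀ i, RealizesFun (g i)) {h : List.Vector ℕ m →. ℕ}
    (hh : ∀ v, ∀ y ∈ h v, ∃ w : Fin n → ℕ, (∀ i, w i ∈ g i v) ∧ y ∈ f (List.Vector.ofFn w)) :
    RealizesFun h := by
  intro inp out base h1 h2 h3
  refine ((Realizable.seq _ fun i => hg i inp (base + i) (base + n)
    (fun j => (h1 j).trans_le (Nat.le_add_right _ _)) (by omega)
    fun j => ((h1 j).trans_le (Nat.le_add_right _ _)).ne).comp
    ((hf (fun i => base + i) out (base + n) (by intro i; omega) (by omega)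
      (by intro i; omega)).comp
    (Realizable.seq _ fun i : Fin n => Realizable.clear (base + i)))).mono ?_
  rintro s s' ⟨h0, hb, y, hy, rfl⟩
  obtain ⟨w, hw, hy⟩ := hh _ y hy
  -- The intermediate values indexed by register address; the witnesses below are the contents after
  -- `k` of the inner functions, after `f`, and after `k` clearings.
  let w' : ℕ → ℕ := fun x => if hx : x - base < n then w ⟨x - base, hx⟩ else 0
  have hw' : ∀ i : Fin n, w' (base + i) = w i := fun i => by simp [w']
  refine ⟨fun x => if base ≤ x ∧ x < base + n then w' x else s x,
    ⟨fun k x => if base ≤ x ∧ x < base + k then w' x else s x, ?_, rfl, fun k => ?_⟩,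
    fun x => if x = out then y else if base ≤ x ∧ x < base + n then w' x else s x,
    ⟨?_, ?_, y, ?_, ?_⟩,
    fun k x => if x = out then y else if base + k ≤ x ∧ x < base + n then w' x else s x,
      rfl, ?_, fun k => ?_⟩
  · ext x; grind
  · refine ⟨?_, ?_, w k, ?_, ?_⟩
    · dsimp only; rw [if_neg (by omega)]; exact hb _ (by omega)
    · intro j hj; dsimp only; rw [if_neg (by omega)]; exact hb _ (by omega)
    · have : (fun i => if base ≤ inp i ∧ inp i < base + k then w' (inp i) else s (inp i)) =
          fun i => s (inp i) := by
        ext i; rw [if_neg]; have := h1 i; omega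
      rw [this]; exact hw k
    · have := hw' k
      ext x; simp only [update_apply]; grind
  · grind
  · intro j hj; dsimp only; rw [if_neg (by omega)]; exact hb _ (by omega)
  · have : (fun i : Fin n => if base ≤ base + (i : ℕ) ∧ base + (i : ℕ) < base + n then
        w' (base + i) else s (base + i)) = w := by
      ext i; rw [if_pos (by omega), hw']
    rw [this]; exact hy
  · ext x; simp only [update_apply]
  · ext x; simp only [update_apply]; grind
  · ext x
    have := hb x
    simp only [update_apply]; grind

theorem prec {n : ℕ} {f : List.Vector ℕ n → ℕ} {g : List.Vector ℕ (n + 2) → ℕ}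
    (hf : RealizesFun (f : List.Vector ℕ n →. ℕ))
    (hg : RealizesFun (g : List.Vector ℕ (n + 2) →. ℕ)) :
    RealizesFun ((fun v : List.Vector ℕ (n + 1) => v.head.rec (f v.tail)
      fun y IH => g (y ::ᵥ IH ::ᵥ v.tail) : List.Vector ℕ (n + 1) → ℕ) :
      List.Vector ℕ (n + 1) →. ℕ) := by
  intro inp out o h1 h2 h3
  -- Register `o` holds the recursion index, `o + 1` the number of rounds left, `o + 2` the value so
  -- far, `o + 3` the new value; scratch space begins at `o + 4`.
  have body : Realizable _ := (Realizable.dec (o + 1)).comp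
    ((hg (Fin.cons o (Fin.cons (o + 2) (Fin.tail inp))) (o + 3) (o + 4)
      (by
        refine Fin.cases (by simp) (Fin.cases (by simp) fun i => ?_)
        have := h1 i.succ
        simp [Fin.tail]; omega)
      (by omega)
      (by
        refine Fin.cases (by simp) (Fin.cases (by simp) fun i => ?_)
        have := h1 i.succ
        simp [Fin.tail]; omega)).comp
    ((Realizable.clear (o + 2)).comp
    ((Realizable.move (i := o + 3) (j := o + 2) (by omega)).comp (Realizable.inc o))))
  refine ((Realizable.addTo (i := inp 0) (j := o + 1) (t := o + 4) (by have := h1 0; omega)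
    (by have := h1 0; omega) (by omega)).comp
    ((hf (Fin.tail inp) (o + 2) (o + 4) (fun i => by have := h1 i.succ; simp [Fin.tail]; omega)
      (by omega) (fun i => by have := h1 i.succ; simp [Fin.tail]; omega)).comp
    ((body.loop (o + 1)).comp
    ((Realizable.move (i := o + 2) (j := out) (by omega)).comp (Realizable.clear o))))).mono ?_
  rintro s s' ⟨h0, hb, y, hy, rfl⟩
  obtain rfl := Part.mem_some_iff.1 hy
  clear hy
  set v : List.Vector ℕ n := List.Vector.ofFn fun i => s (inp i.succ) with hv
  have hhead : (List.Vector.ofFn fun i => s (inp i)).head = s (inp 0) := by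
    simp [List.Vector.ofFn]
  have htail : (List.Vector.ofFn fun i => s (inp i)).tail = v := by
    simp [List.Vector.ofFn, hv]
  simp only [hhead, htail]
  let F : ℕ → ℕ := Nat.rec (f v) fun y IH => g (y ::ᵥ IH ::ᵥ v)
  have hF0 : F 0 = f v := rfl
  -- The contents when `k` rounds are left.
  let st : ℕ → ℕ → ℕ := fun k =>
    update (update (update s o (s (inp 0) - k)) (o + 1) k) (o + 2) (F (s (inp 0) - k))
  have hinp : ∀ k i, st k (inp i) = s (inp i) := fun k i => by
    have := h1 i
    simp only [st]
    rw [update_of_ne (by omega), update_of_ne (by omega), update_of_ne (by omega)]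
  refine ⟨update s (o + 1) (s (inp 0)), ⟨hb _ (by omega), ?_⟩, st (s (inp 0)), ?_, st 0,
    ⟨?_, ?_⟩, update (update (update s o (s (inp 0))) (o + 1) 0) out (F (s (inp 0))), ?_, ?_⟩
  · rw [hb (o + 1) (by omega), zero_add]
  · refine ⟨?_, ?_, f v, ?_, ?_⟩
    · rw [update_of_ne (by omega)]; exact hb _ (by omega)
    · intro j hj
      rw [update_of_ne (by omega)]; exact hb _ (by omega)
    · refine Part.mem_some_iff.2 (congrArg f (congrArg List.Vector.ofFn (funext fun i => ?_)))
      have := h1 i.succ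
      rw [update_of_ne (by simp [Fin.tail]; omega)]; rfl
    · have := hb o le_rfl
      ext x
      simp only [st, Nat.sub_self, hF0]
      simp only [update_apply]; grind
  · suffices ∀ k ≤ s (inp 0), Relation.ReflTransGen _ (st k) (st 0) from this _ le_rfl
    intro k hk
    induction k with
    | zero => exact .refl
    | succ k ih =>
      refine .head ⟨by simp [st], update (st (k + 1)) (o + 1) k, ⟨by simp [st], by simp [st]⟩,
        update (update (st (k + 1)) (o + 1) k) (o + 3) (F (s (inp 0) - k)),
        ⟨?_, ?_, F (s (inp 0) - k), ?_, rfl⟩, _, rfl, _, rfl, ?_⟩ (ih (by omega))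
      · have := hb (o + 3) (by omega)
        simpa [st] using this
      · intro j hj
        have := hb j (by omega)
        simp only [st]
        simp only [update_apply]; grind
      · have hF : F (s (inp 0) - k) =
            g ((s (inp 0) - (k + 1)) ::ᵥ F (s (inp 0) - (k + 1)) ::ᵥ v) := by
          have : s (inp 0) - k = s (inp 0) - (k + 1) + 1 := by omega
          rw [this]
        rw [hF]
        refine Part.mem_some_iff.2 (congrArg g ?_)
        simp only [List.Vector.ofFn, Fin.cons_zero, Fin.cons_succ, hv]
        congr 1
        · simp [st]
        · congr 1
          · simp [st]
          · refine congrArg List.Vector.ofFn (funext fun i => ?_)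
            have := h1 i.succ
            rw [update_of_ne (by simp [Fin.tail]; omega)]
            exact (hinp _ _).symm
      · have := hb (o + 3) (by omega)
        ext x
        simp only [st]
        simp only [update_apply]; grind
  · simp [st]
  · have := hb (o + 2) (by omega)
    ext x
    simp only [st]
    simp only [update_apply]; grind
  · have := hb o le_rfl
    have := hb (o + 1) (by omega)
    ext x
    change update s out (F (s (inp 0))) x = _
    simp only [update_apply]; grind

/-- The register `out`, initially `0`, is the search variable, and `o` holds the value of `f` there.
Success means that this value is `0`, so the loop ends with `o` already clean. -/
theorem rfind {n : ℕ} {f : List.Vector ℕ (n + 1) → ℕ}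
    (hf : RealizesFun (f : List.Vector ℕ (n + 1) →. ℕ)) :
    RealizesFun fun v => Nat.rfind fun n => Part.some (decide (f (n ::ᵥ v) = 0)) := by
  intro inp out o h1 h2 h3
  have hF := hf (Fin.cons out inp) o (o + 1)
    (by
      refine Fin.cases (by simp; omega) fun i => ?_
      have := h1 i
      simp; omega)
    (by omega)
    (by
      refine Fin.cases (by simp; omega) fun i => ?_
      have := h1 i
      simp; omega)
  refine (hF.comp
    (((Realizable.clear o).comp ((Realizable.inc out).comp hF)).loop o)).mono ?_
  rintro s s' ⟨h0, hb, y, hy, rfl⟩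
  set v : List.Vector ℕ n := List.Vector.ofFn fun i => s (inp i) with hv
  obtain ⟨hy0, hlt⟩ := Nat.mem_rfind.1 hy
  have hy0 : f (y ::ᵥ v) = 0 := by simpa using hy0
  have hlt : ∀ k < y, f (k ::ᵥ v) ≠ 0 := fun k hk => by simpa using hlt hk
  let st : ℕ → ℕ → ℕ := fun k => update (update s out k) o (f (k ::ᵥ v))
  have key : ∀ k, f (k ::ᵥ v) ∈ (f : List.Vector ℕ (n + 1) →. ℕ) (List.Vector.ofFn fun i =>
      update s out k ((Fin.cons out inp : Fin (n + 1) → ℕ) i)) := by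
    intro k
    refine Part.mem_some_iff.2 (congrArg f ?_)
    simp only [List.Vector.ofFn, Fin.cons_zero, Fin.cons_succ, update_self, hv]
    congr 2
    ext i
    rw [update_of_ne (h3 i)]
  have key0 := key 0
  have hs : update s out 0 = s := by rw [← h0, update_eq_self]
  rw [hs] at key0
  refine ⟨st 0, ⟨hb _ le_rfl, fun j hj => hb j (by omega), _, key0, by simp only [st, hs]⟩, ?_, ?_⟩
  · have hyst : update s out y = st y := by
      have := hb o le_rfl
      ext x
      simp only [st, hy0]
      simp only [update_apply]; grind
    rw [hyst]
    suffices ∀ k ≤ y, Relation.ReflTransGen _ (st 0) (st k) from this _ le_rfl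
    intro k hk
    induction k with
    | zero => exact .refl
    | succ k ih =>
      refine .tail (ih (by omega)) ⟨?_, update s out k, ?_, update s out (k + 1), ?_, ?_, ?_, _,
        key (k + 1), rfl⟩
      · simpa [st] using hlt k hk
      · have := hb o le_rfl
        ext x
        simp only [st]
        simp only [update_apply]; grind
      · simp
      · have := hb o le_rfl
        simp only [update_apply]; grind
      · intro j hj
        have := hb j (by omega)
        simp only [update_apply]; grind
  · have := hb o le_rfl
    simp only [update_apply]; grind

theorem of_primrec' {n : ℕ} {f : List.Vector ℕ n → ℕ} (hf : Nat.Primrec' f) :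
    RealizesFun (f : List.Vector ℕ n →. ℕ) := by
  induction hf with
  | zero => exact zero
  | succ => exact succ
  | get i => exact get i
  | comp g _ _ hf hg =>
    refine hf.comp hg fun v y hy => ⟨fun i => g i v, fun i => Part.mem_some _, hy⟩
  | prec _ _ hf hg => exact hf.prec hg

theorem _root_.List.Vector.get_mem_of_mem_mOfFn {n : ℕ} {f : Fin n → Part ℕ} {w : List.Vector ℕ n}
    (hw : w ∈ List.Vector.mOfFn f) (i : Fin n) : w.get i ∈ f i := by
  induction n with
  | zero => exact i.elim0
  | succ n ih =>
    obtain ⟨a, ha, hw⟩ := Part.mem_bind_iff.1 hw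
    obtain ⟨v, hv, hw⟩ := Part.mem_bind_iff.1 hw
    obtain rfl := Part.mem_some_iff.1 hw
    refine Fin.cases ?_ (fun i => ?_) i
    · simpa using ha
    · simpa using ih hv i

theorem of_partrec' {n : ℕ} {f : List.Vector ℕ n →. ℕ} (hf : Nat.Partrec' f) : RealizesFun f := by
  induction hf with
  | prim h => exact of_primrec' h
  | comp g _ _ hf hg =>
    refine hf.comp hg fun v y hy => ?_
    obtain ⟨w, hw, hy⟩ := Part.mem_bind_iff.1 hy
    exact ⟨w.get, List.Vector.get_mem_of_mem_mOfFn hw, by rwa [List.Vector.ofFn_get]⟩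
  | rfind _ hf => exact hf.rfind

end RealizesFun

/-- A single machine separates the arguments on which a partial recursive function takes the
value `0` from those on which it takes a positive value. -/
theorem exists_machine_of_partrec {f : ℕ →. ℕ} (hf : Partrec f) :
    ∃ M : ResidueMachine Bool, ∀ n, ∀ y ∈ f n, ∃ N, M.Eval (2 ^ n) (decide (y ≠ 0)) N := by
  obtain ⟨M, hM⟩ := RealizesFun.of_partrec' (Nat.Partrec'.part_iff₁.2 hf) (fun _ => 0) 1 2
    (by simp) (by simp) (by simp)
  refine ⟨M.bind fun _ => .test (Nat.nth Nat.Prime 1) (Nat.prime_nth_prime 1).pos,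
    fun n y hy => ?_⟩
  obtain ⟨N, hN, hE⟩ := hM _ _ _ ⟨by simp, fun j hj => Function.update_of_ne (by omega) _ _, y,
    by simpa [List.Vector.ofFn] using hy, rfl⟩ (RegisterCode.init n)
  refine ⟨N, hE.bind ?_⟩
  have h := hN.dvd_iff 1
  simp only [Function.update_self] at h
  simp only [← h]
  exact ResidueMachine.eval_test _ _ _

/-! ### The two-counter MDP that simulates a residue machine. -/

namespace ResidueMachine

/-- The vector in dimension two with entry `x` at `i` and entry `y` at the other index. -/
def pt {α : Type} (i : Fin 2) (x y : α) : Fin 2 → α := fun j => if j = i then x else y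

theorem pt_self {α : Type} (i : Fin 2) (x y : α) : pt i x y i = x := if_pos rfl

theorem pt_rev {α : Type} (i : Fin 2) (x y : α) : pt i.rev x y = pt i y x := by
  ext j
  fin_cases i <;> fin_cases j <;> rfl

/-- The counter values after adding the vector `w`. -/
def shift (v : Fin 2 → ℕ) (w : Fin 2 → ℤ) : Fin 2 → ℕ := fun j => ((v j : ℤ) + w j).toNat

theorem shift_zero (v : Fin 2 → ℕ) : shift v 0 = v := by
  ext j; simp [shift]

theorem shift_self_pt (v : Fin 2 → ℕ) (i : Fin 2) (x y : ℤ) :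
    shift v (pt i x y) i = (v i + x).toNat := by
  simp [shift, pt_self]

theorem shift_pt (i : Fin 2) (x y : ℕ) (x' y' : ℤ) :
    shift (pt i x y) (pt i x' y') = pt i (x + x').toNat (y + y').toNat := by
  ext j
  simp only [shift, pt]
  split_ifs <;> rfl

variable (M : ResidueMachine Bool)

/-- The control states of the MDP that simulates `M`. One counter holds the number of `M`, the
other one accumulates the next number, and the two exchange their roles after each step of `M`. -/
inductive Ctl
  | loc (s : M.S) (i : Fin 2)
  | dec (s : M.S) (i : Fin 2)
  | exit (s : M.S) (i : Fin 2) (r : Fin (M.modulus s))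
  | check (t : M.S ⊕ Bool) (i : Fin 2)
  | accept
  | sink

instance : Finite M.Ctl := by
  refine Finite.of_surjective (α := (M.S × Fin 2) ⊕ (M.S × Fin 2) ⊕
    ((Σ s, Fin (M.modulus s)) × Fin 2) ⊕ ((M.S ⊕ Bool) × Fin 2) ⊕ Bool)
    (Sum.elim (fun z => .loc z.1 z.2) <| Sum.elim (fun z => .dec z.1 z.2) <|
      Sum.elim (fun z => .exit z.1.1 z.2 z.1.2) <| Sum.elim (fun z => .check z.1 z.2)
      fun b => bif b then .accept else .sink) ?_
  rintro (⟨s, i⟩ | ⟨s, i⟩ | ⟨s, i, r⟩ | ⟨t, i⟩ | _ | _)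
  exacts [⟨.inl (s, i), rfl⟩, ⟨.inr (.inl (s, i)), rfl⟩, ⟨.inr (.inr (.inl (⟨s, r⟩, i))), rfl⟩,
    ⟨.inr (.inr (.inr (.inl (t, i)))), rfl⟩, ⟨.inr (.inr (.inr (.inr true))), rfl⟩,
    ⟨.inr (.inr (.inr (.inr false))), rfl⟩]

variable {M}

/-- The control state that represents a state or an exit of `M`; the exit `false` is accepting. -/
def entry (t : M.S ⊕ Bool) (i : Fin 2) : M.Ctl :=
  t.elim (fun s => .loc s i) fun b => bif b then .sink else .accept

/-- The vectors and targets of the transitions that leave a control state. -/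
def out : M.Ctl → Set ((Fin 2 → ℤ) × M.Ctl)
  | .loc s i => insert (0, .dec s i) (Set.range fun r => (0, .exit s i r))
  | .dec s i => {(pt i (-(M.modulus s : ℤ)) (M.factor s : ℤ), .loc s i), (0, .dec s i)}
  | .exit s i r =>
    {(pt i (-(r : ℤ)) (M.offset s r : ℤ), .check (M.next s r) i), (0, .exit s i r)}
  -- The decrement is enabled exactly when counter `i` is nonzero; the other transition exchanges
  -- the roles of the counters.
  | .check t i => {(pt i (-1) 0, .sink), (0, entry t i.rev)}
  | .accept => {(0, .accept)}
  | .sink => {(0, .sink)}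

theorem finite_out (q : M.Ctl) : (out q).Finite := by
  cases q <;> simp only [out] <;> exact Set.toFinite _

theorem exists_zero_mem_out (q : M.Ctl) : ∃ q', (0, q') ∈ out q := by
  cases q <;> simp [out]

variable (M) in
noncomputable def ctlEquiv : M.Ctl ≃ Fin (Nat.card M.Ctl) := Finite.equivFin _

noncomputable def tr (q : M.Ctl) (w : Fin 2 → ℤ) (q' : M.Ctl) :
    Transition (Fin (Nat.card M.Ctl)) 2 :=
  ⟨M.ctlEquiv q, w, M.ctlEquiv q'⟩

noncomputable def cfg (q : M.Ctl) (v : Fin 2 → ℕ) : Config (Fin (Nat.card M.Ctl)) 2 :=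
  ⟨M.ctlEquiv q, v⟩

theorem exists_eq_cfg (c : Config (Fin (Nat.card M.Ctl)) 2) : ∃ q v, c = cfg (M := M) q v :=
  ⟨M.ctlEquiv.symm c.state, c.val, by ext <;> simp [cfg]⟩

theorem fire_tr (q q' : M.Ctl) (w : Fin 2 → ℤ) (v : Fin 2 → ℕ) :
    (tr q w q').fire (cfg q v) = cfg q' (shift v w) := rfl

variable (M) in
theorem finite_transitions : {t : Transition (Fin (Nat.card M.Ctl)) 2 |
    (t.vec, M.ctlEquiv.symm t.tgt) ∈ out (M.ctlEquiv.symm t.src)}.Finite := by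
  refine (Set.finite_iUnion fun q : M.Ctl => (finite_out q).image
    fun p => tr q p.1 p.2).subset fun t ht => ?_
  exact Set.mem_iUnion.2 ⟨_, _, ht, by ext <;> simp [tr]⟩

variable (M) in
open Classical in
/-- The MDP that simulates `M`. Player 1 decides in `loc s i` whether the counter `i` is at least the
modulus of `s`, and announces its value otherwise. -/
noncomputable def mdp : VASSMDP (Fin (Nat.card M.Ctl)) 2 where
  Q₁ := {k | ∃ s i, M.ctlEquiv.symm k = .loc s i}
  T := M.finite_transitions.toFinset
  weight _ := 1
  weight_pos _ _ := one_pos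

theorem cfg_state_mem (q : M.Ctl) (v : Fin 2 → ℕ) :
    (cfg q v).state ∈ M.mdp.Q₁ ↔ ∃ s i, q = .loc s i := by
  simp [mdp, cfg]

theorem mem_enabled (q : M.Ctl) (v : Fin 2 → ℕ) (t : Transition (Fin (Nat.card M.Ctl)) 2) :
    t ∈ M.mdp.T ∧ t.Enabled (cfg q v) ↔
      ∃ p ∈ out q, (∀ j, 0 ≤ (v j : ℤ) + p.1 j) ∧ t = tr q p.1 p.2 := by
  simp only [mdp, Set.Finite.mem_toFinset, Set.mem_ofPred_eq, Transition.Enabled]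
  constructor
  · rintro ⟨h1, h2, h3⟩
    obtain ⟨a, w, b⟩ := t
    obtain rfl : a = M.ctlEquiv q := h2
    rw [Equiv.symm_apply_apply] at h1
    exact ⟨_, h1, h3, by simp [tr]⟩
  · rintro ⟨p, hp, h3, rfl⟩
    exact ⟨by simpa [tr] using hp, rfl, h3⟩

theorem step_cfg_iff (q : M.Ctl) (v : Fin 2 → ℕ) (c' : Config (Fin (Nat.card M.Ctl)) 2) :
    M.mdp.Step (cfg q v) c' ↔
      ∃ p ∈ out q, (∀ j, 0 ≤ (v j : ℤ) + p.1 j) ∧ c' = cfg p.2 (shift v p.1) := by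
  simp only [VASSMDP.Step, ← and_assoc, mem_enabled]
  constructor
  · rintro ⟨t, ⟨p, ⟨hp, h⟩, rfl⟩, rfl⟩
    exact ⟨p, ⟨hp, h⟩, rfl⟩
  · rintro ⟨p, hp, rfl⟩
    exact ⟨_, ⟨p, hp, rfl⟩, rfl⟩

theorem step_of_zero_mem_out {q q' : M.Ctl} (h : (0, q') ∈ out q) (v : Fin 2 → ℕ) :
    M.mdp.Step (cfg q v) (cfg q' v) :=
  (step_cfg_iff _ _ _).2 ⟨_, h, by simp, by rw [shift_zero]⟩

variable (M) in
theorem deadlockFree_mdp : M.mdp.DeadlockFree := by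
  intro c
  obtain ⟨q, v, rfl⟩ := exists_eq_cfg c
  obtain ⟨q', h⟩ := exists_zero_mem_out q
  exact ⟨_, step_of_zero_mem_out h v⟩

variable (M) in
theorem isPVASS_mdp : M.mdp.IsPVASS := by
  intro t ht hQ
  obtain ⟨a, w, b⟩ := t
  simp only [mdp, Set.Finite.mem_toFinset, Set.mem_ofPred_eq, Finset.mem_filter,
    Finset.mem_univ, true_and] at ht hQ
  obtain ⟨s, i, h⟩ := hQ
  rw [h] at ht
  rcases ht with h | ⟨r, h⟩
  exacts [congrArg Prod.fst h, (congrArg Prod.fst h).symm]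

section Expectation

variable {q q₁ q₂ : M.Ctl} {w : Fin 2 → ℤ} {v : Fin 2 → ℕ}
  (g : Config (Fin (Nat.card M.Ctl)) 2 → ℝ≥0∞)

theorem lintegral_of_out_eq_singleton (h : out q = {(0, q₁)}) :
    ∫⁻ y, g y ∂(M.mdp.succDist M.deadlockFree_mdp (cfg q v)).toMeasure = g (cfg q₁ v) := by
  rw [VASSMDP.lintegral_succDist_single _ _ g (tr q 0 q₁), fire_tr, shift_zero]
  intro t
  simp [mem_enabled, h]

theorem lintegral_of_out_eq_pair (h : out q = {(w, q₁), (0, q₂)}) (hne : (w, q₁) ≠ (0, q₂))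
    (hw : ∀ j, 0 ≤ (v j : ℤ) + w j) :
    ∫⁻ y, g y ∂(M.mdp.succDist M.deadlockFree_mdp (cfg q v)).toMeasure =
      (g (cfg q₁ (shift v w)) + g (cfg q₂ v)) / 2 := by
  rw [VASSMDP.lintegral_succDist_pair _ _ g (tr q w q₁) (tr q 0 q₂), fire_tr, fire_tr, shift_zero]
  · intro h
    simp only [tr, Transition.mk.injEq] at h
    exact hne (Prod.ext h.2.1 (M.ctlEquiv.injective h.2.2))
  · intro t
    simp [mem_enabled, h, hw]
  · exact fun _ => rfl

theorem lintegral_of_out_eq_pair_of_not (h : out q = {(w, q₁), (0, q₂)})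
    (hw : ¬ ∀ j, 0 ≤ (v j : ℤ) + w j) :
    ∫⁻ y, g y ∂(M.mdp.succDist M.deadlockFree_mdp (cfg q v)).toMeasure = g (cfg q₂ v) := by
  rw [VASSMDP.lintegral_succDist_single _ _ g (tr q 0 q₂), fire_tr, shift_zero]
  intro t
  simp only [mem_enabled, h, Set.mem_insert_iff, Set.mem_singleton_iff, exists_eq_or_imp,
    exists_eq_left, hw, false_and, false_or]
  simp

end Expectation

/-! ### Honest play follows the machine. -/

theorem shift_pt_nonneg {v : Fin 2 → ℕ} {i : Fin 2} {m a : ℕ} :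
    (∀ j, 0 ≤ (v j : ℤ) + pt i (-(m : ℤ)) (a : ℤ) j) ↔ m ≤ v i := by
  constructor
  · intro h
    have := h i
    rw [pt_self] at this
    omega
  · intro h j
    simp only [pt]
    split_ifs with hj
    · subst hj; omega
    · omega

/-- The moves of a play in which Player 1 never cheats, without the waiting moves. -/
inductive Honest : M.Ctl × (Fin 2 → ℕ) → M.Ctl × (Fin 2 → ℕ) → Prop
  | dec {s i} {v : Fin 2 → ℕ} : M.modulus s ≤ v i → Honest (.loc s i, v) (.dec s i, v)
  | transfer {s i} {v : Fin 2 → ℕ} : M.modulus s ≤ v i →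
    Honest (.dec s i, v) (.loc s i, shift v (pt i (-(M.modulus s : ℤ)) (M.factor s : ℤ)))
  | exit {s i} {v : Fin 2 → ℕ} {r : Fin (M.modulus s)} : v i = (r : ℕ) → Honest (.loc s i, v) (.exit s i r, v)
  | check {s i} {v : Fin 2 → ℕ} {r : Fin (M.modulus s)} : v i = (r : ℕ) →
    Honest (.exit s i r, v)
      (.check (M.next s r) i, shift v (pt i (-(r : ℤ)) (M.offset s r : ℤ)))
  | pass {t i} {v : Fin 2 → ℕ} : v i = 0 → Honest (.check t i, v) (entry t i.rev, v)

theorem honest_transfer (s : M.S) (i : Fin 2) (r k y : ℕ) :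
    Relation.ReflTransGen Honest (.loc s i, pt i (M.modulus s * k + r) y)
      (.loc s i, pt i r (M.factor s * k + y)) := by
  induction k generalizing y with
  | zero => simp only [mul_zero, zero_add]; exact .refl
  | succ k ih =>
    have h : M.modulus s ≤ pt i (M.modulus s * (k + 1) + r) y i := by
      rw [pt_self, mul_add_one]; omega
    refine .head (.dec h) (.head (.transfer h) ?_)
    convert! ih (M.factor s + y) using 2
    · rw [shift_pt]; congr 1
      · push_cast; rw [mul_add_one]; omega
      · omega
    · ring_nf

/-- Subtracting the true residue empties counter `i`, so `check` is passed, and after the exchange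
of roles the accumulating counter is again zero. -/
theorem honest_of_step {x x' : (M.S ⊕ Bool) × ℕ} (h : M.Step x x') (i : Fin 2) :
    Relation.ReflTransGen Honest (entry x.1 i, pt i x.2 0)
      (entry x'.1 i.rev, pt i.rev x'.2 0) := by
  obtain ⟨s, k, r, hr⟩ := h
  refine (honest_transfer s i r k 0).trans
    (.head (.exit (r := ⟨r, hr⟩) (pt_self _ _ _)) (.head (.check (pt_self _ _ _)) (.single ?_)))
  rw [shift_pt, pt_rev]
  have h1 : ((r : ℤ) + -((⟨r, hr⟩ : Fin (M.modulus s)) : ℕ)).toNat = 0 := by simp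
  rw [h1, add_zero]
  convert! Honest.pass (M := M) (pt_self i 0 _) using 3

theorem honest_of_eval {N N' : ℕ} {b : Bool} (h : M.Eval N b N') :
    ∃ v, Relation.ReflTransGen Honest (.loc M.start 0, pt 0 N 0)
      ((bif b then .sink else .accept : M.Ctl), v) := by
  suffices ∀ x x' : (M.S ⊕ Bool) × ℕ, Relation.ReflTransGen M.Step x x' → ∀ i, ∃ i',
      Relation.ReflTransGen Honest (entry x.1 i, pt i x.2 0) (entry x'.1 i', pt i' x'.2 0) by
    obtain ⟨i', h⟩ := this _ _ h 0
    exact ⟨_, h⟩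
  intro x x' h
  induction h with
  | refl => exact fun i => ⟨i, .refl⟩
  | tail _ hs ih =>
    intro i
    obtain ⟨i', h⟩ := ih i
    exact ⟨_, h.trans (honest_of_step hs i')⟩

/-! ### Honest play accepts almost surely when the machine exits with `false`. -/

section Accept

/-- The choices of Player 1 when he does not cheat. -/
noncomputable def honestMove (c : Config (Fin (Nat.card M.Ctl)) 2) :
    Config (Fin (Nat.card M.Ctl)) 2 :=
  match M.ctlEquiv.symm c.state with
  | .loc s i => if h : c.val i < M.modulus s then cfg (.exit s i ⟨c.val i, h⟩) c.val
    else cfg (.dec s i) c.val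
  | _ => c

theorem honestMove_loc (s : M.S) (i : Fin 2) (v : Fin 2 → ℕ) :
    honestMove (cfg (.loc s i) v) = if h : v i < M.modulus s then cfg (.exit s i ⟨v i, h⟩) v
      else cfg (.dec s i) v := by
  simp only [honestMove, cfg, Equiv.symm_apply_apply]
  rfl

theorem step_honestMove (c : Config (Fin (Nat.card M.Ctl)) 2) (hc : c.state ∈ M.mdp.Q₁) :
    M.mdp.Step c (honestMove (M := M) c) := by
  obtain ⟨q, v, rfl⟩ := exists_eq_cfg c
  obtain ⟨s, i, rfl⟩ := (cfg_state_mem _ _).1 hc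
  rw [honestMove_loc]
  split_ifs with h
  · exact step_of_zero_mem_out (by simp [out]) v
  · exact step_of_zero_mem_out (by simp [out]) v

variable (M) in
noncomputable def honestStrategy : M.mdp.Strategy :=
  M.mdp.positional (honestMove (M := M)) step_honestMove

variable (M) in
open Classical in
/-- The probability that `accept` is the control state at time `n` of the honest play from `c`. -/
noncomputable def acceptProb (n : ℕ) (c : Config (Fin (Nat.card M.Ctl)) 2) : ℝ≥0∞ :=
  (M.mdp.positionalOp M.deadlockFree_mdp (honestMove (M := M)))^[n]
    (fun c => if c.state = M.ctlEquiv .accept then 1 else 0) c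

theorem prob_accept (n : ℕ) (c : Config (Fin (Nat.card M.Ctl)) 2) :
    M.mdp.playMeasure M.deadlockFree_mdp M.honestStrategy c
      {ω | (ω n).state = M.ctlEquiv .accept} = M.acceptProb n c :=
  (M.mdp.prob_state_positional M.deadlockFree_mdp c (honestMove (M := M)) step_honestMove n _).trans
    (by unfold acceptProb; congr!)

theorem acceptProb_le_one (n : ℕ) (c : Config (Fin (Nat.card M.Ctl)) 2) :
    M.acceptProb n c ≤ 1 := by
  rw [← prob_accept]; exact prob_le_one

theorem acceptProb_succ_loc (n : ℕ) (s : M.S) (i : Fin 2) (v : Fin 2 → ℕ) :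
    M.acceptProb (n + 1) (cfg (.loc s i) v) = M.acceptProb n (honestMove (cfg (.loc s i) v)) := by
  unfold acceptProb
  rw [Function.iterate_succ_apply', VASSMDP.positionalOp, if_pos ((cfg_state_mem _ _).2 ⟨s, i, rfl⟩)]

theorem acceptProb_succ (n : ℕ) {q : M.Ctl} (hq : ∀ s i, q ≠ .loc s i) (v : Fin 2 → ℕ) :
    M.acceptProb (n + 1) (cfg q v) = ∫⁻ y, M.acceptProb n y
      ∂(M.mdp.succDist M.deadlockFree_mdp (cfg q v)).toMeasure := by
  have : ¬ (cfg q v).state ∈ M.mdp.Q₁ := by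
    rw [cfg_state_mem]; rintro ⟨s, i, h⟩; exact hq s i h
  unfold acceptProb
  rw [Function.iterate_succ_apply', VASSMDP.positionalOp, if_neg this]

-- Since `accept` is absorbing, its indicator lies below its image under the one-step operator, and
-- iterating preserves this.
variable (M) in
theorem monotone_acceptProb : Monotone M.acceptProb := by
  refine Monotone.monotone_iterate_of_le_map (VASSMDP.positionalOp_mono _ _ _) fun c => ?_
  obtain ⟨q, v, rfl⟩ := exists_eq_cfg c
  split_ifs with h
  · obtain rfl : q = .accept := M.ctlEquiv.injective h
    change 1 ≤ M.acceptProb 1 _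
    rw [acceptProb_succ _ (by simp), lintegral_of_out_eq_singleton _ rfl]
    simp [acceptProb, cfg]
  · exact zero_le

/-- Waiting in a self-loop loses nothing: the limit satisfies `u = (1 + u) / 2` and is finite, hence
equals `1`. -/
theorem iSup_acceptProb_of_pair {c c' : Config (Fin (Nat.card M.Ctl)) 2}
    (h : ∀ n, M.acceptProb (n + 1) c = (M.acceptProb n c' + M.acceptProb n c) / 2)
    (h' : ⨆ n, M.acceptProb n c' = 1) : ⨆ n, M.acceptProb n c = 1 := by
  have hm : ∀ c, Monotone fun n => M.acceptProb n c := fun c _ _ hmn => M.monotone_acceptProb hmn c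
  have hle : ⨆ n, M.acceptProb n c ≤ 1 := iSup_le fun n => acceptProb_le_one n c
  have heq : ⨆ n, M.acceptProb n c = (1 + ⨆ n, M.acceptProb n c) / 2 := by
    conv_lhs => rw [← (hm c).iSup_nat_add 1]
    simp only [h]
    rw [← h', ENNReal.iSup_add_iSup_of_monotone (hm c') (hm c), ENNReal.iSup_div]
  generalize (⨆ n, M.acceptProb n c) = u at *
  lift u to NNReal using ne_top_of_le_ne_top ENNReal.one_ne_top hle
  have h2 : (u : ℝ≥0∞) * 2 = 1 + u := by
    conv_lhs => rw [heq]
    exact ENNReal.div_mul_cancel (by simp) (by simp)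
  have h3 : u * 2 = 1 + u := by exact_mod_cast h2
  have h4 : (u : ℝ) * 2 = 1 + u := by exact_mod_cast h3
  have h5 : (u : ℝ) = 1 := by linarith
  exact_mod_cast h5

theorem iSup_acceptProb_of_eq {c c' : Config (Fin (Nat.card M.Ctl)) 2}
    (h : ∀ n, M.acceptProb (n + 1) c = M.acceptProb n c')
    (h' : ⨆ n, M.acceptProb n c' = 1) : ⨆ n, M.acceptProb n c = 1 := by
  have hm : Monotone fun n => M.acceptProb n c := fun _ _ hmn => M.monotone_acceptProb hmn c
  rw [← hm.iSup_nat_add 1, ← h']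
  simp only [h]

/-- An honest move is either certain or competes only with a self-loop, so limit value `1` passes
backwards along it. -/
theorem iSup_acceptProb_of_honest {x x' : M.Ctl × (Fin 2 → ℕ)} (h : Honest x x')
    (h' : ⨆ n, M.acceptProb n (cfg x'.1 x'.2) = 1) :
    ⨆ n, M.acceptProb n (cfg x.1 x.2) = 1 := by
  cases h with
  | dec h =>
    refine iSup_acceptProb_of_eq (fun n => ?_) h'
    rw [acceptProb_succ_loc, honestMove_loc, dif_neg (not_lt.2 h)]
  | @exit s i v r h =>
    refine iSup_acceptProb_of_eq (fun n => ?_) h'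
    have hr : v i < M.modulus s := h ▸ r.2
    have hr' : (⟨v i, hr⟩ : Fin _) = r := Fin.ext h
    rw [acceptProb_succ_loc, honestMove_loc, dif_pos hr, hr']
  | transfer h =>
    refine iSup_acceptProb_of_pair (fun n => ?_) h'
    rw [acceptProb_succ _ (by simp), lintegral_of_out_eq_pair _ rfl (by simp)
      (shift_pt_nonneg.2 h)]
  | check h =>
    refine iSup_acceptProb_of_pair (fun n => ?_) h'
    rw [acceptProb_succ _ (by simp), lintegral_of_out_eq_pair _ rfl (by simp)
      (shift_pt_nonneg.2 h.ge)]
  | pass h =>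
    refine iSup_acceptProb_of_eq (fun n => ?_) h'
    rw [acceptProb_succ _ (by simp), lintegral_of_out_eq_pair_of_not _ rfl]
    intro hw
    have := shift_pt_nonneg (m := 1) (a := 0).1 (by simpa only [Nat.cast_one, Nat.cast_zero] using hw)
    omega

theorem iSup_acceptProb_eq_one {x : M.Ctl × (Fin 2 → ℕ)} {v : Fin 2 → ℕ}
    (h : Relation.ReflTransGen Honest x (.accept, v)) :
    ⨆ n, M.acceptProb n (cfg x.1 x.2) = 1 := by
  induction h using Relation.ReflTransGen.head_induction_on with
  | refl =>
    refine le_antisymm (iSup_le fun n => acceptProb_le_one n _) (le_iSup_of_le 0 ?_)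
    simp [acceptProb, cfg]
  | head h1 _ ih => exact iSup_acceptProb_of_honest h1 ih

theorem prob_repeatedReach_accept {x : M.Ctl × (Fin 2 → ℕ)} {v : Fin 2 → ℕ}
    (h : Relation.ReflTransGen Honest x (.accept, v)) :
    M.mdp.playMeasure M.deadlockFree_mdp M.honestStrategy (cfg x.1 x.2)
      (repeatedReachEvent (M.ctlEquiv .accept)) = 1 := by
  refine M.mdp.prob_repeatedReachEvent_eq_one _ _ _ _ fun N => ?_
  simp only [prob_accept]
  have hm : Monotone fun n => M.acceptProb n (cfg x.1 x.2) :=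
    fun _ _ hmn => M.monotone_acceptProb hmn _
  -- By monotonicity, dropping the first `N` times does not change the supremum.
  rw [← iSup_acceptProb_eq_one h, ← hm.iSup_nat_add N]
  simp only [add_comm]

end Accept

/-! ### No strategy exceeds probability 1/2 when the machine exits with `true`. -/

section Reject

/-- Configurations that Player 1 reaches by cheating only. -/
def Bad : M.Ctl → (Fin 2 → ℕ) → Prop
  | .dec s i, v => v i < M.modulus s
  | .exit _ i r, v => v i ≠ r
  | .check _ i, v => v i ≠ 0
  | _, _ => False

/-- Honest continuations are unique, so honest play from such a configuration can only end in
`sink`; with `Bad` included, every deviation by Player 1 stays inside the set. -/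
def Doomed (x : M.Ctl × (Fin 2 → ℕ)) : Prop :=
  Bad x.1 x.2 ∨ ∃ v, Relation.ReflTransGen Honest x (.sink, v)

theorem Doomed.exists_honest {q : M.Ctl} {v : Fin 2 → ℕ} (h : Doomed (q, v)) (hb : ¬ Bad q v)
    (hq : q ≠ .sink) : ∃ x, Honest (q, v) x ∧ Doomed x := by
  obtain ⟨w, h⟩ := h.resolve_left hb
  rcases h.cases_head with h | ⟨x, h1, h2⟩
  · exact absurd (congrArg Prod.fst h) hq
  · exact ⟨x, h1, .inr ⟨w, h2⟩⟩

open Classical in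
/-- An upper bound for the winning probability of Player 1. -/
noncomputable def bound (q : M.Ctl) (v : Fin 2 → ℕ) : ℝ≥0∞ :=
  -- The value 1/2 is forced by `check` at a nonzero counter: half of the weight goes to `sink`, the
  -- other half gets the trivial bound `1`.
  if q = .sink then 0 else if Doomed (q, v) then 2⁻¹ else 1

theorem bound_le_one (q : M.Ctl) (v : Fin 2 → ℕ) : bound q v ≤ 1 := by
  unfold bound
  split_ifs <;> simp

theorem Doomed.bound_le {q : M.Ctl} {v : Fin 2 → ℕ} (h : Doomed (q, v)) : bound q v ≤ 2⁻¹ := by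
  unfold bound
  split_ifs <;> simp

noncomputable def cfgBound (c : Config (Fin (Nat.card M.Ctl)) 2) : ℝ≥0∞ :=
  bound (M.ctlEquiv.symm c.state) c.val

theorem cfgBound_cfg (q : M.Ctl) (v : Fin 2 → ℕ) : cfgBound (cfg q v) = bound q v := by
  simp [cfgBound, cfg]

theorem add_div_two_le {a b c : ℝ≥0∞} (ha : a ≤ c) (hb : b ≤ c) : (a + b) / 2 ≤ c :=
  (ENNReal.div_le_div_right (add_le_add ha hb) 2).trans
    (by rw [← two_mul, mul_comm, ENNReal.mul_div_cancel_right (by simp) (by simp)])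

/-- From a doomed `loc`, the honest choice is doomed by uniqueness, and every other choice is `Bad`.
-/
theorem bound_step {s : M.S} {i : Fin 2} {v : Fin 2 → ℕ} {p : (Fin 2 → ℤ) × M.Ctl}
    (hp : p ∈ out (.loc s i)) : bound p.2 (shift v p.1) ≤ bound (.loc s i) v := by
  by_cases hd : Doomed (.loc s i, v)
  · have hb : bound (.loc s i) v = 2⁻¹ := by simp [bound, hd]
    rw [hb]
    refine Doomed.bound_le ?_
    obtain ⟨x, hx, hdx⟩ := hd.exists_honest (by simp [Bad]) (by simp)
    cases hx with
    | dec h =>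
      rcases hp with rfl | ⟨r, rfl⟩
      · rwa [shift_zero]
      · rw [shift_zero]
        exact .inl (by simp only [Bad]; have := r.2; omega)
    | @exit _ _ _ r h =>
      rcases hp with rfl | ⟨r', rfl⟩
      · rw [shift_zero]
        exact .inl (by simp only [Bad]; have := r.2; omega)
      · rw [shift_zero]
        by_cases hr : r' = r
        · rwa [hr]
        · exact .inl (by simp only [Bad]; intro h'; exact hr (Fin.ext (by omega)))
  · have hb : bound (.loc s i) v = 1 := by simp [bound, hd]
    rw [hb]
    exact bound_le_one _ _

theorem lintegral_cfgBound_le {q : M.Ctl} (hq : ∀ s i, q ≠ .loc s i) (v : Fin 2 → ℕ) :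
    ∫⁻ y, cfgBound y ∂(M.mdp.succDist M.deadlockFree_mdp (cfg q v)).toMeasure ≤ bound q v := by
  by_cases hs : q = .sink
  · subst hs
    rw [lintegral_of_out_eq_singleton _ rfl, cfgBound_cfg]
  by_cases hd : Doomed (q, v)
  swap
  · have hb : bound q v = 1 := by simp [bound, hd, hs]
    rw [hb]
    refine (lintegral_mono fun c => bound_le_one _ _).trans ?_
    simp
  have hb : bound q v = 2⁻¹ := by simp [bound, hd, hs]
  have hself : cfgBound (cfg q v) ≤ 2⁻¹ := by rw [cfgBound_cfg]; exact hb.le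
  rw [hb]
  cases q with
  | loc s i => exact absurd rfl (hq s i)
  | sink => exact absurd rfl hs
  | accept => rwa [lintegral_of_out_eq_singleton _ rfl]
  | dec s i =>
    by_cases h : M.modulus s ≤ v i
    · rw [lintegral_of_out_eq_pair _ rfl (by simp) (shift_pt_nonneg.2 h)]
      refine add_div_two_le ?_ hself
      obtain ⟨x, hx, hdx⟩ := hd.exists_honest (by simpa [Bad] using h) (by simp)
      cases hx with
      | transfer _ => rw [cfgBound_cfg]; exact hdx.bound_le
    -- The subtraction is impossible, so the play stays put.
    · rwa [lintegral_of_out_eq_pair_of_not _ rfl (shift_pt_nonneg.not.2 h)]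
  | exit s i r =>
    by_cases h : (r : ℕ) ≤ v i
    · rw [lintegral_of_out_eq_pair _ rfl (by simp) (shift_pt_nonneg.2 h)]
      refine add_div_two_le ?_ hself
      rw [cfgBound_cfg]
      by_cases hr : v i = r
      · obtain ⟨x, hx, hdx⟩ := hd.exists_honest (by simpa [Bad] using hr) (by simp)
        cases hx with
        | check _ => exact hdx.bound_le
      -- Too small an announced residue leaves a positive rest, which makes the following `check`
      -- bad.
      · exact Doomed.bound_le (.inl (by simp only [Bad, shift_self_pt]; omega))
    · rwa [lintegral_of_out_eq_pair_of_not _ rfl (shift_pt_nonneg.not.2 h)]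
  | check t i =>
    by_cases h : v i = 0
    · obtain ⟨x, hx, hdx⟩ := hd.exists_honest (by simpa [Bad] using h) (by simp)
      rw [lintegral_of_out_eq_pair_of_not _ rfl]
      · cases hx with
        | pass _ => rw [cfgBound_cfg]; exact hdx.bound_le
      · intro hw
        have := shift_pt_nonneg (m := 1) (a := 0).1 (by simpa only [Nat.cast_one, Nat.cast_zero] using hw)
        omega
    · have hw := shift_pt_nonneg (m := 1) (a := 0).2 (Nat.one_le_iff_ne_zero.2 h)
      have hs0 : ∀ v, bound (M := M) .sink v = 0 := fun v => if_pos rfl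
      have hne : (pt i (-1) 0 : Fin 2 → ℤ) ≠ 0 := fun h0 => by
        have := congrFun h0 i
        simp [pt_self] at this
      -- Here the lie is punished: the expectation is `(0 + b) / 2` with `b ≤ 1`.
      rw [lintegral_of_out_eq_pair (w := pt i (-1) 0) _ rfl (fun h => hne (congrArg Prod.fst h)) (by simpa only [Nat.cast_one, Nat.cast_zero] using hw),
        cfgBound_cfg, cfgBound_cfg, hs0, zero_add, ← one_div]
      exact ENNReal.div_le_div_right (bound_le_one _ _) 2

theorem prob_reach_accept_le {x : M.Ctl × (Fin 2 → ℕ)} {v : Fin 2 → ℕ}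
    (h : Relation.ReflTransGen Honest x (.sink, v)) (σ : M.mdp.Strategy) :
    M.mdp.playMeasure M.deadlockFree_mdp σ (cfg x.1 x.2)
      (reachEvent (M.ctlEquiv .accept)) ≤ 2⁻¹ := by
  refine (M.mdp.prob_reachEvent_le M.deadlockFree_mdp σ _ _ cfgBound ?_ ?_ ?_).trans
    ((cfgBound_cfg _ _).le.trans (Doomed.bound_le (.inr ⟨v, h⟩)))
  · intro c hc
    obtain ⟨q, v, rfl⟩ := exists_eq_cfg c
    obtain rfl : q = .accept := M.ctlEquiv.injective hc
    -- No honest move leaves `accept`, so its bound is `1`.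
    have hd : ¬ Doomed (M := M) (.accept, v) := fun hd => by
      obtain ⟨x, hx, -⟩ := hd.exists_honest (by simp [Bad]) (by simp)
      cases hx
    rw [cfgBound_cfg]
    simp [bound, hd]
  · intro c c' hc hs
    obtain ⟨q, v, rfl⟩ := exists_eq_cfg c
    obtain ⟨s, i, rfl⟩ := (cfg_state_mem _ _).1 hc
    obtain ⟨p, hp, -, rfl⟩ := (step_cfg_iff _ _ _).1 hs
    rw [cfgBound_cfg, cfgBound_cfg]
    exact bound_step hp
  · intro c hc
    obtain ⟨q, v, rfl⟩ := exists_eq_cfg c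
    rw [cfgBound_cfg]
    exact lintegral_cfgBound_le (fun s i h => hc ((cfg_state_mem _ _).2 ⟨s, i, h⟩)) v

end Reject

end ResidueMachine

/-! ### The computable reduction and recursive inseparability. -/

namespace ResidueMachine

variable (M : ResidueMachine Bool)

/-- The input of the reachability problems that simulates `M` on the number `N`. -/
noncomputable def instanceOf (N : ℕ) : PInstance 2 where
  numStates := Nat.card M.Ctl
  sys := M.mdp
  deadlockFree := M.deadlockFree_mdp
  isPVASS := M.isPVASS_mdp
  init := cfg (.loc M.start 0) (pt 0 N 0)
  target := M.ctlEquiv .accept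

/-- A description of `M.instanceOf N`. -/
noncomputable def codeOf (N : ℕ) : PInstance.Code :=
  -- The transitions do not depend on `N`, so those of `M.instanceOf 0` serve for all.
  (List.ofFn fun q => decide (q ∈ M.mdp.Q₁), M.mdp.T.toList.map (M.instanceOf 0).transitionCode,
    ((M.ctlEquiv (.loc M.start 0) : ℕ), [N, 0]), (M.ctlEquiv .accept : ℕ))

theorem isCode_codeOf (N : ℕ) : (M.instanceOf N).IsCode (M.codeOf N) where
  states := rfl
  nodup := by
    refine (Finset.nodup_toList _).map ?_
    rintro ⟨a, w, b⟩ ⟨a', w', b'⟩ h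
    simp only [PInstance.transitionCode, Prod.mk.injEq, Fin.val_inj] at h
    obtain ⟨rfl, h, rfl, -⟩ := h
    rw [List.ofFn_injective h]
  transitions _ :=
    List.mem_map.trans (exists_congr fun _ => and_congr Finset.mem_toList eq_comm)
  init := by
    simp [codeOf, instanceOf, cfg, List.ofFn_succ, pt]
  target := rfl

variable {M} in
theorem exists_prob_eq_one_of_eval {N N' : ℕ} (h : M.Eval N false N') :
    ∃ σ : (M.instanceOf N).sys.Strategy,
      (M.instanceOf N).prob σ (repeatedReachEvent (M.instanceOf N).target) = 1 := by
  obtain ⟨v, hv⟩ := honest_of_eval h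
  exact ⟨M.honestStrategy, prob_repeatedReach_accept (x := (.loc M.start 0, pt 0 N 0)) hv⟩

variable {M} in
theorem prob_le_of_eval {N N' : ℕ} (h : M.Eval N true N') (σ : (M.instanceOf N).sys.Strategy) :
    (M.instanceOf N).prob σ (reachEvent (M.instanceOf N).target) ≤ 2⁻¹ := by
  obtain ⟨v, hv⟩ := honest_of_eval h
  exact prob_reach_accept_le (x := (.loc M.start 0, pt 0 N 0)) hv σ

/-- Only the initial counter value varies with `n`. All other entries are constants, so the
nonconstructive numbering of states and listing of transitions do no harm. -/
theorem computable_codeOf : Computable fun n => M.codeOf (2 ^ n) := by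
  have hpow : Computable fun n : ℕ => 2 ^ n :=
    (Primrec.nat_rec₁ 1 (Primrec.nat_mul.comp (Primrec.const 2) Primrec.snd).to₂).to_comp.of_eq
      fun n => by
        induction n with
        | zero => rfl
        | succ n ih => rw [pow_succ, ← ih, mul_comm]
  exact (Computable.const _).pair ((Computable.const _).pair
    (((Computable.const _).pair
      (Computable.list_cons.comp hpow (Computable.const [0]))).pair (Computable.const _)))

end ResidueMachine

/-- No computable function separates the arguments with diagonal value `0` from those with diagonal
value `1`. -/
theorem not_computable_separation (d : ℕ → Bool) (hd : Computable d)
    (h0 : ∀ n, 0 ∈ (Denumerable.ofNat Nat.Partrec.Code n).eval n → d n = true)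
    (h1 : ∀ n, 1 ∈ (Denumerable.ofNat Nat.Partrec.Code n).eval n → d n = false) : False := by
  -- A program for this function, run on its own code, outputs the value that contradicts the
  -- verdict of `d` there.
  have hg : Computable fun n => bif d n then 1 else 0 :=
    Computable.cond hd (Computable.const 1) (Computable.const 0)
  obtain ⟨c, hc⟩ := Nat.Partrec.Code.exists_code.1 (Partrec.nat_iff.1 hg.partrec)
  have he : c.eval (Encodable.encode c) = Part.some (bif d (Encodable.encode c) then 1 else 0) := by
    rw [hc]; rfl
  have h0 := h0 (Encodable.encode c)
  have h1 := h1 (Encodable.encode c)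
  rw [Denumerable.ofNat_encode, he] at h0 h1
  cases h : d (Encodable.encode c) <;> simp [h] at h0 h1

/-- The two hypotheses pair the strongest positive answer (some strategy repeats almost surely) with
the strongest negative one (even single visits have probability at most 1/2); each of the four
problems respects both. -/
theorem not_decidableProblem (P : PInstance 2 → Prop)
    (hacc : ∀ I : PInstance 2,
      (∃ σ : I.sys.Strategy, I.prob σ (repeatedReachEvent I.target) = 1) → P I)
    (hrej : ∀ I : PInstance 2,
      (∀ σ : I.sys.Strategy, I.prob σ (reachEvent I.target) ≤ 2⁻¹) → ¬ P I) :
    ¬ DecidableProblem P := by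
  rintro ⟨f, hf, hfP⟩
  have hK : Partrec fun n => (Denumerable.ofNat Nat.Partrec.Code n).eval n :=
    Nat.Partrec.Code.eval_part.comp (Computable.ofNat _) Computable.id
  obtain ⟨M, hM⟩ := exists_machine_of_partrec hK
  refine not_computable_separation (fun n => f (M.codeOf (2 ^ n)))
    (hf.comp M.computable_codeOf) (fun n hn => ?_) (fun n hn => ?_)
  · obtain ⟨N, hN⟩ := hM n 0 hn
    exact (hfP _ _ (M.isCode_codeOf _)).2 (hacc _ (ResidueMachine.exists_prob_eq_one_of_eval hN))
  · obtain ⟨N, hN⟩ := hM n 1 hn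
    exact Bool.eq_false_iff.2
      ((hfP _ _ (M.isCode_codeOf _)).not.2 (hrej _ (ResidueMachine.prob_le_of_eval hN)))

namespace PInstance

variable {d : ℕ} (I : PInstance d)

theorem prob_le_one (σ : I.sys.Strategy) (E : Set (ℕ → Config (Fin I.numStates) d)) :
    I.prob σ E ≤ 1 :=
  MeasureTheory.prob_le_one (μ := I.sys.playMeasure I.deadlockFree σ I.init)

theorem prob_repeatedReach_le (σ : I.sys.Strategy) :
    I.prob σ (repeatedReachEvent I.target) ≤ I.prob σ (reachEvent I.target) :=
  measure_mono (VASSMDP.repeatedReachEvent_subset_reachEvent _)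

variable {I}

theorem iSup_prob_eq_one {E : Set (ℕ → Config (Fin I.numStates) d)}
    (h : ∃ σ : I.sys.Strategy, I.prob σ E = 1) : ⨆ σ : I.sys.Strategy, I.prob σ E = 1 := by
  obtain ⟨σ, h⟩ := h
  exact le_antisymm (iSup_le fun σ => I.prob_le_one σ E) (h ▸ le_iSup (fun σ => I.prob σ E) σ)

theorem iSup_prob_ne_one {E : Set (ℕ → Config (Fin I.numStates) d)}
    (h : ∀ σ : I.sys.Strategy, I.prob σ E ≤ 2⁻¹) : ⨆ σ : I.sys.Strategy, I.prob σ E ≠ 1 :=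
  ((iSup_le h).trans_lt (by simp [ENNReal.inv_lt_one])).ne

theorem prob_reach_eq_one {σ : I.sys.Strategy}
    (h : I.prob σ (repeatedReachEvent I.target) = 1) : I.prob σ (reachEvent I.target) = 1 :=
  le_antisymm (I.prob_le_one σ _) (h.symm.le.trans (I.prob_repeatedReach_le σ))

theorem not_exists_prob_eq_one {E : Set (ℕ → Config (Fin I.numStates) d)}
    (h : ∀ σ : I.sys.Strategy, I.prob σ E ≤ 2⁻¹) : ¬ ∃ σ : I.sys.Strategy, I.prob σ E = 1 :=
  fun hE => iSup_prob_ne_one h (iSup_prob_eq_one hE)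

end PInstance

theorem mainTheorem7 :
    ¬ DecidableProblem (d := 2) PInstance.AlmostSureReach ∧
    ¬ DecidableProblem (d := 2) PInstance.LimitSureReach ∧
    ¬ DecidableProblem (d := 2) PInstance.AlmostSureRepeatedReach ∧
    ¬ DecidableProblem (d := 2) PInstance.LimitSureRepeatedReach := by
  refine ⟨?_, ?_, ?_, ?_⟩
  · exact not_decidableProblem _ (fun I h => h.imp fun σ => PInstance.prob_reach_eq_one)
      fun I h => PInstance.not_exists_prob_eq_one h
  · exact not_decidableProblem _
      (fun I h => PInstance.iSup_prob_eq_one (h.imp fun σ => PInstance.prob_reach_eq_one))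
      fun I h => PInstance.iSup_prob_ne_one h
  · exact not_decidableProblem _ (fun I h => h) fun I h =>
      PInstance.not_exists_prob_eq_one fun σ => (I.prob_repeatedReach_le σ).trans (h σ)
  · exact not_decidableProblem _ (fun I h => PInstance.iSup_prob_eq_one h) fun I h =>
      PInstance.iSup_prob_ne_one fun σ => (I.prob_repeatedReach_le σ).trans (h σ)
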